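/- Let $0<x_0<1$ and $k\in\mathbb Z\setminus\{0\}$, let $L_k u = \frac{d}{dx}\big[(1-x^2)\frac{du}{dx}\big]-\frac{k^2}{1-x^2}u$ on $[-x_0,x_0]$, and let $X_0$ be the space of complex-valued functions $\Psi$ on $[-x_0,x_0]$ with $\int_{-x_0}^{x_0}\big[(1-x^2)|\Psi'|^2+\frac{k^2}{1-x^2}|\Psi|^2\big]dx<\infty$ and $\Psi(\pm x_0)=\Psi'(\pm x_0)=0$. Consider the eigenvalue problem $$L_k\Psi=\Phi,\qquad L_k\Phi=\mu\Phi,\qquad \Psi\in X_0,$$ where $\Phi$ satisfies no boundary conditions. (This is the linearization of the Navier--Stokes equations on the truncated spherical layer at Reynolds number $\varepsilon=0$.) Its spectrum is the set of those $\mu\in\mathbb C$ for which it is not true that, for every $F\in L^2(-x_0,x_0)$, the system $L_k\Psi=\Phi$, $L_k\Phi-\mu\Phi=F$ has exactly one solution $\Psi\in X_0$, such that, for a constant $C$ independent of $F$, $\int_{-x_0}^{x_0}\big[(1-x^2)|\Psi'|^2+\frac{k^2}{1-x^2}|\Psi|^2+|\Phi|^2\big]dx\le C\int_{-x_0}^{x_0}|F|^2dx$.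 The spectrum consists of eigenvalues only, that is, every $\mu$ in the spectrum has an eigenfunction $\Psi\neq0$ in $X_0$. Every eigenvalue is an isolated point of the spectrum, is real and strictly negative, and is either (algebraically) simple, or double with two linearly independent eigenfunctions in $X_0$, one even and one odd. Here the algebraic multiplicity of $\mu$ is the dimension of the space of all generalized eigenfunctions, i.e. of all $\Psi_n$ that end a finite chain $\Psi_0=0,\Psi_1,\dots,\Psi_n\in X_0$ with $(L_k-\mu)L_k\Psi_{j}=L_k\Psi_{j-1}$ for $1\le j\le n$. -/

import Mathlib

open MeasureTheory Set

noncomputable section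

namespace SphericalLayer

/-- The energy density `(1 - x²) |Ψ'(x)|² + k² / (1 - x²) |Ψ(x)|²`. -/
def energyDensity (k : ℤ) (Ψ : ℝ → ℂ) (x : ℝ) : ℝ :=
  (1 - x ^ 2) * ‖deriv Ψ x‖ ^ 2 + (k : ℝ) ^ 2 / (1 - x ^ 2) * ‖Ψ x‖ ^ 2

/-- The squared norm of the energy space `H_k([-x₀, x₀])`. -/
def energyNormSq (k : ℤ) (x₀ : ℝ) (Ψ : ℝ → ℂ) : ℝ :=
  ∫ x in Icc (-x₀) x₀, energyDensity k Ψ x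

/-- The function space `X₀`: functions of `H_k([-x₀, x₀])` (absolutely continuous, of finite energy)
with `Ψ(±x₀) = Ψ'(±x₀) = 0`. A function on `[-x₀, x₀]` is represented by its extension by zero to the
real line, so that equality of functions on `[-x₀, x₀]` is equality in `ℝ → ℂ`. -/
structure MemX₀ (k : ℤ) (x₀ : ℝ) (Ψ : ℝ → ℂ) : Prop where
  eq_zero_off : ∀ x, x ∉ Icc (-x₀) x₀ → Ψ x = 0
  absolutelyContinuous : AbsolutelyContinuousOnInterval Ψ (-x₀) x₀
  finite_energy : IntegrableOn (energyDensity k Ψ) (Icc (-x₀) x₀)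
  left : Ψ (-x₀) = 0
  right : Ψ x₀ = 0
  deriv_left : HasDerivWithinAt Ψ 0 (Icc (-x₀) x₀) (-x₀)
  deriv_right : HasDerivWithinAt Ψ 0 (Icc (-x₀) x₀) x₀

/-- `L_k u = g` on `[-x₀, x₀]`, where
`L_k u = ((1 - x²) u')' - k² / (1 - x²) u` is the associated Legendre operator with its maximal domain
in `L²(-x₀, x₀)`: `u` is differentiable on the closed interval (one-sidedly at the end points),
`(1 - x²) u'` is absolutely continuous with derivative `g + k² / (1 - x²) u` almost everywhere, that
is, it is the indefinite integral of this function, and `g` is square integrable. No boundary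
condition is imposed on `u`, and only the values of `u` and `g` on the interval matter. -/
structure LegendreEq (k : ℤ) (x₀ : ℝ) (u g : ℝ → ℂ) : Prop where
  differentiableOn : DifferentiableOn ℝ u (Icc (-x₀) x₀)
  memLp : MemLp g 2 (volume.restrict (Icc (-x₀) x₀))
  flux : ∀ x ∈ Icc (-x₀) x₀,
    ((1 - x ^ 2 : ℝ) : ℂ) * derivWithin u (Icc (-x₀) x₀) x =
      ((1 - x₀ ^ 2 : ℝ) : ℂ) * derivWithin u (Icc (-x₀) x₀) (-x₀) +
        ∫ t in (-x₀)..x, (g t + (((k : ℝ) ^ 2 / (1 - t ^ 2) : ℝ) : ℂ) * u t)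

/-- The linearized system in `X₀` with a source term `F`:
`Ψ ∈ X₀`, `L_k Ψ = Φ` and `L_k Φ + ε Φ' - μ Φ = F` on `[-x₀, x₀]`. -/
structure IsSolution (k : ℤ) (ε x₀ : ℝ) (μ : ℂ) (F Ψ Φ : ℝ → ℂ) : Prop where
  memX₀ : MemX₀ k x₀ Ψ
  stream_eq : LegendreEq k x₀ Ψ Φ
  vorticity_eq : LegendreEq k x₀ Φ
    (fun x => μ * Φ x - (ε : ℂ) * derivWithin Φ (Icc (-x₀) x₀) x + F x)

/-- `μ` is in the resolvent set of the problem in `X₀`: for every square integrable source the system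
has exactly one solution, and it depends boundedly on the source. -/
def IsResolventPoint (k : ℤ) (ε x₀ : ℝ) (μ : ℂ) : Prop :=
  (∀ F : ℝ → ℂ, MemLp F 2 (volume.restrict (Icc (-x₀) x₀)) →
    ∃! Ψ : ℝ → ℂ, ∃ Φ : ℝ → ℂ, IsSolution k ε x₀ μ F Ψ Φ) ∧
  ∃ C : ℝ, ∀ F Ψ Φ : ℝ → ℂ, MemLp F 2 (volume.restrict (Icc (-x₀) x₀)) →
    IsSolution k ε x₀ μ F Ψ Φ →
      energyNormSq k x₀ Ψ + ∫ x in Icc (-x₀) x₀, ‖Φ x‖ ^ 2 ≤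
        C * ∫ x in Icc (-x₀) x₀, ‖F x‖ ^ 2

/-- The complete spectrum of the eigenvalue problem in `X₀`. -/
def problemSpectrum (k : ℤ) (ε x₀ : ℝ) : Set ℂ :=
  {μ | ¬ IsResolventPoint k ε x₀ μ}

/-! ### Linearity -/

theorem LegendreEq.congr {k : ℤ} {x₀ : ℝ} {u g h : ℝ → ℂ} (H : LegendreEq k x₀ u g)
    (e : ∀ x ∈ Icc (-x₀) x₀, h x = g x) : LegendreEq k x₀ u h := by
  refine ⟨H.differentiableOn, ?_, ?_⟩
  · refine (memLp_congr_ae ?_).2 H.memLp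
    exact (ae_restrict_iff' measurableSet_Icc).2 (Filter.Eventually.of_forall e)
  · intro x hx
    rw [H.flux x hx]
    congr 1
    refine intervalIntegral.integral_congr fun t ht => ?_
    rw [uIcc_of_le hx.1] at ht
    simp only [e t ⟨ht.1, ht.2.trans hx.2⟩]

theorem LegendreEq.zero (k : ℤ) (x₀ : ℝ) : LegendreEq k x₀ 0 0 := by
  refine ⟨differentiableOn_const 0, MemLp.zero, ?_⟩
  intro x _
  have h : derivWithin (0 : ℝ → ℂ) (Icc (-x₀) x₀) = 0 := by
    exact derivWithin_const (F := ℂ) (𝕜 := ℝ) _ (0 : ℂ)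
  simp [h]

theorem weight_continuousOn {k : ℤ} {x₀ : ℝ} (h1 : x₀ < 1) :
    ContinuousOn (fun t : ℝ => (((k : ℝ) ^ 2 / (1 - t ^ 2) : ℝ) : ℂ)) (Icc (-x₀) x₀) := by
  refine Complex.continuous_ofReal.comp_continuousOn ?_
  refine ContinuousOn.div (by fun_prop) (by fun_prop) fun t ht => ?_
  have : t ^ 2 < 1 := by nlinarith [ht.1, ht.2]
  linarith

theorem LegendreEq.intervalIntegrable {k : ℤ} {x₀ : ℝ} {u g : ℝ → ℂ} (h1 : x₀ < 1)
    (H : LegendreEq k x₀ u g) {x : ℝ} (hx : x ∈ Icc (-x₀) x₀) :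
    IntervalIntegrable (fun t => g t + (((k : ℝ) ^ 2 / (1 - t ^ 2) : ℝ) : ℂ) * u t)
      volume (-x₀) x := by
  rw [intervalIntegrable_iff_integrableOn_Icc_of_le hx.1]
  have hs : Icc (-x₀) x ⊆ Icc (-x₀) x₀ := Icc_subset_Icc_right hx.2
  refine Integrable.add ?_ ?_
  · exact (H.memLp.integrable (by norm_num)).mono_measure (Measure.restrict_mono hs le_rfl)
  · exact (((weight_continuousOn h1).mul H.differentiableOn.continuousOn).integrableOn_compact
      isCompact_Icc).mono_set hs

theorem LegendreEq.add {k : ℤ} {x₀ : ℝ} {u g v h : ℝ → ℂ} (h0 : 0 < x₀) (h1 : x₀ < 1)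
    (H : LegendreEq k x₀ u g) (H' : LegendreEq k x₀ v h) :
    LegendreEq k x₀ (u + v) (g + h) := by
  refine ⟨H.differentiableOn.add H'.differentiableOn, H.memLp.add H'.memLp, ?_⟩
  intro x hx
  have hl : (-x₀) ∈ Icc (-x₀) x₀ := ⟨le_rfl, by linarith⟩
  rw [derivWithin_add (H.differentiableOn x hx) (H'.differentiableOn x hx),
    derivWithin_add (H.differentiableOn _ hl) (H'.differentiableOn _ hl), mul_add, mul_add,
    H.flux x hx, H'.flux x hx]
  have e : (fun t => (g + h) t + (((k : ℝ) ^ 2 / (1 - t ^ 2) : ℝ) : ℂ) * (u + v) t) =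
      fun t => (g t + (((k : ℝ) ^ 2 / (1 - t ^ 2) : ℝ) : ℂ) * u t) +
        (h t + (((k : ℝ) ^ 2 / (1 - t ^ 2) : ℝ) : ℂ) * v t) := by
    ext t; simp only [Pi.add_apply]; ring
  rw [e, intervalIntegral.integral_add (H.intervalIntegrable h1 hx) (H'.intervalIntegrable h1 hx)]
  ring

theorem LegendreEq.smul {k : ℤ} {x₀ : ℝ} {u g : ℝ → ℂ} (c : ℂ) (H : LegendreEq k x₀ u g) :
    LegendreEq k x₀ (c • u) (c • g) := by
  refine ⟨H.differentiableOn.const_smul c, H.memLp.const_smul c, ?_⟩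
  intro x hx
  have hd : ∀ y ∈ Icc (-x₀) x₀, derivWithin (c • u) (Icc (-x₀) x₀) y =
      c * derivWithin u (Icc (-x₀) x₀) y := fun y hy => by
    rw [derivWithin_const_smul c (H.differentiableOn y hy), smul_eq_mul]
  have e : (fun t => (c • g) t + (((k : ℝ) ^ 2 / (1 - t ^ 2) : ℝ) : ℂ) * (c • u) t) =
      fun t => c * (g t + (((k : ℝ) ^ 2 / (1 - t ^ 2) : ℝ) : ℂ) * u t) := by
    ext t; simp only [Pi.smul_apply, smul_eq_mul]; ring
  rw [hd x hx, hd _ ⟨le_rfl, hx.1.trans hx.2⟩, e, intervalIntegral.integral_const_mul,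
    mul_left_comm, H.flux x hx]
  ring

theorem MemX₀.zero (k : ℤ) (x₀ : ℝ) : MemX₀ k x₀ 0 := by
  refine ⟨fun _ _ => rfl, ?_, ?_, rfl, rfl, ?_, ?_⟩
  · exact (LipschitzWith.const (0 : ℂ)).lipschitzOnWith.absolutelyContinuousOnInterval
  · have : energyDensity k 0 = 0 := by
      ext x
      have h : deriv (0 : ℝ → ℂ) x = 0 := deriv_const x (0 : ℂ)
      simp [energyDensity, h]
    rw [this]; exact integrableOn_zero
  · exact hasDerivWithinAt_const _ _ (0 : ℂ)
  · exact hasDerivWithinAt_const _ _ (0 : ℂ)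

theorem MemX₀.add {k : ℤ} {x₀ : ℝ} {u v : ℝ → ℂ} (h1 : x₀ < 1)
    (hu : DifferentiableOn ℝ u (Icc (-x₀) x₀)) (hv : DifferentiableOn ℝ v (Icc (-x₀) x₀))
    (H : MemX₀ k x₀ u) (H' : MemX₀ k x₀ v) : MemX₀ k x₀ (u + v) := by
  refine ⟨fun x hx => by simp [H.eq_zero_off x hx, H'.eq_zero_off x hx],
    H.absolutelyContinuous.add H'.absolutelyContinuous, ?_, by simp [H.left, H'.left],
    by simp [H.right, H'.right], by simpa using H.deriv_left.add H'.deriv_left,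
    by simpa using H.deriv_right.add H'.deriv_right⟩
  have hint : IntegrableOn (fun x => 2 * (energyDensity k u x + energyDensity k v x))
      (Icc (-x₀) x₀) := (H.finite_energy.add H'.finite_energy).const_mul 2
  rw [integrableOn_Icc_iff_integrableOn_Ioo] at hint ⊢
  have hsub : Ioo (-x₀) x₀ ⊆ Icc (-x₀) x₀ := Ioo_subset_Icc_self
  refine Integrable.mono' hint ?_ ?_
  · have hm : AEStronglyMeasurable (u + v) (volume.restrict (Ioo (-x₀) x₀)) :=
      ((hu.add hv).continuousOn.mono hsub).aestronglyMeasurable measurableSet_Ioo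
    have hd : AEStronglyMeasurable (deriv (u + v)) (volume.restrict (Ioo (-x₀) x₀)) :=
      (measurable_deriv _).aestronglyMeasurable
    have p1 : AEStronglyMeasurable (fun x : ℝ => 1 - x ^ 2) (volume.restrict (Ioo (-x₀) x₀)) :=
      (by fun_prop : Measurable fun x : ℝ => 1 - x ^ 2).aestronglyMeasurable
    have p2 : AEStronglyMeasurable (fun x : ℝ => (k : ℝ) ^ 2 / (1 - x ^ 2))
        (volume.restrict (Ioo (-x₀) x₀)) :=
      (by fun_prop : Measurable fun x : ℝ => (k : ℝ) ^ 2 / (1 - x ^ 2)).aestronglyMeasurable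
    exact (p1.mul (hd.norm.pow 2)).add (p2.mul (hm.norm.pow 2))
  · refine (ae_restrict_iff' measurableSet_Ioo).2 (Filter.Eventually.of_forall fun x hx => ?_)
    have hn : Icc (-x₀) x₀ ∈ nhds x := Icc_mem_nhds hx.1 hx.2
    have du := (hu x (hsub hx)).differentiableAt hn
    have dv := (hv x (hsub hx)).differentiableAt hn
    have hp : 0 ≤ 1 - x ^ 2 := by nlinarith [hx.1, hx.2]
    have hq : 0 ≤ (k : ℝ) ^ 2 / (1 - x ^ 2) := by positivity
    have key : ∀ a b : ℂ, ‖a + b‖ ^ 2 ≤ 2 * (‖a‖ ^ 2 + ‖b‖ ^ 2) := fun a b => by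
      nlinarith [norm_add_le a b, norm_nonneg (a + b), sq_nonneg (‖a‖ - ‖b‖),
        norm_nonneg a, norm_nonneg b]
    have hnn : 0 ≤ energyDensity k (u + v) x := by unfold energyDensity; positivity
    rw [Real.norm_of_nonneg hnn]
    unfold energyDensity
    rw [deriv_add du dv, Pi.add_apply]
    nlinarith [mul_le_mul_of_nonneg_left (key (deriv u x) (deriv v x)) hp,
      mul_le_mul_of_nonneg_left (key (u x) (v x)) hq]

theorem MemX₀.smul {k : ℤ} {x₀ : ℝ} {u : ℝ → ℂ} (c : ℂ) (H : MemX₀ k x₀ u) :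
    MemX₀ k x₀ (c • u) := by
  refine ⟨fun x hx => by simp [H.eq_zero_off x hx], ?_, ?_, by simp [H.left],
    by simp [H.right], by simpa using H.deriv_left.const_smul c,
    by simpa using H.deriv_right.const_smul c⟩
  · exact H.absolutelyContinuous.const_smul c
  · have e : energyDensity k (c • u) = fun x => ‖c‖ ^ 2 * energyDensity k u x := by
      ext x
      have hd : deriv (c • u) x = c • deriv u x := by
        exact deriv_const_smul_field c u
      simp only [energyDensity, hd, Pi.smul_apply, norm_smul]
      ring
    rw [e]
    exact H.finite_energy.const_mul _

theorem IsSolution.zero (k : ℤ) (ε x₀ : ℝ) (μ : ℂ) : IsSolution k ε x₀ μ 0 0 0 := by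
  refine ⟨MemX₀.zero k x₀, LegendreEq.zero k x₀, (LegendreEq.zero k x₀).congr fun x _ => ?_⟩
  have h : derivWithin (0 : ℝ → ℂ) (Icc (-x₀) x₀) x = 0 := by
    exact congrFun (derivWithin_const (F := ℂ) (𝕜 := ℝ) _ (0 : ℂ)) x
  simp [h]

theorem IsSolution.add {k : ℤ} {ε x₀ : ℝ} {μ : ℂ} {F Ψ Φ F' Ψ' Φ' : ℝ → ℂ} (h0 : 0 < x₀)
    (h1 : x₀ < 1) (H : IsSolution k ε x₀ μ F Ψ Φ) (H' : IsSolution k ε x₀ μ F' Ψ' Φ') :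
    IsSolution k ε x₀ μ (F + F') (Ψ + Ψ') (Φ + Φ') := by
  refine ⟨H.memX₀.add h1 H.stream_eq.differentiableOn H'.stream_eq.differentiableOn H'.memX₀,
    H.stream_eq.add h0 h1 H'.stream_eq,
    (H.vorticity_eq.add h0 h1 H'.vorticity_eq).congr fun x hx => ?_⟩
  rw [derivWithin_add (H.vorticity_eq.differentiableOn x hx)
    (H'.vorticity_eq.differentiableOn x hx)]
  simp only [Pi.add_apply]
  ring

theorem IsSolution.smul {k : ℤ} {ε x₀ : ℝ} {μ : ℂ} {F Ψ Φ : ℝ → ℂ} (c : ℂ)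
    (H : IsSolution k ε x₀ μ F Ψ Φ) : IsSolution k ε x₀ μ (c • F) (c • Ψ) (c • Φ) := by
  refine ⟨H.memX₀.smul c, H.stream_eq.smul c, (H.vorticity_eq.smul c).congr fun x hx => ?_⟩
  rw [derivWithin_const_smul c (H.vorticity_eq.differentiableOn x hx)]
  simp only [Pi.smul_apply, smul_eq_mul]
  ring

/-! ### Eigenvalues and their multiplicities -/

/-- The eigenspace of `μ`: all `Ψ ∈ X₀` with `L_k Ψ = Φ`, `L_k Φ + ε Φ' = μ Φ` for some `Φ`. -/
def eigenspace (k : ℤ) (ε x₀ : ℝ) (h0 : 0 < x₀) (h1 : x₀ < 1) (μ : ℂ) :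
    Submodule ℂ (ℝ → ℂ) where
  carrier := {Ψ | ∃ Φ : ℝ → ℂ, IsSolution k ε x₀ μ 0 Ψ Φ}
  zero_mem' := ⟨0, IsSolution.zero k ε x₀ μ⟩
  add_mem' := by
    rintro a b ⟨Φ, h⟩ ⟨Φ', h'⟩
    exact ⟨Φ + Φ', by simpa using h.add h0 h1 h'⟩
  smul_mem' := by
    rintro c a ⟨Φ, h⟩
    exact ⟨c • Φ, by simpa using h.smul c⟩

/-- `μ` is an eigenvalue: there is a nonzero eigenfunction in `X₀`. -/
def IsEigenvalue (k : ℤ) (ε x₀ : ℝ) (μ : ℂ) : Prop :=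
  ∃ Ψ Φ : ℝ → ℂ, Ψ ≠ 0 ∧ IsSolution k ε x₀ μ 0 Ψ Φ

/-- Generalized eigenfunctions of rank at most `n`: those of rank at most `n + 1` are the `Ψ ∈ X₀` with
`L_k Ψ = Φ` and `L_k Φ + ε Φ' - μ Φ = L_k Ψ'` for a generalized eigenfunction `Ψ'` of rank at most
`n` (for `n = 0` this is the eigenspace). -/
def generalizedEigenspace (k : ℤ) (ε x₀ : ℝ) (h0 : 0 < x₀) (h1 : x₀ < 1) (μ : ℂ) :
    ℕ → Submodule ℂ (ℝ → ℂ)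
  | 0 => ⊥
  | n + 1 =>
    { carrier := {Ψ | ∃ Ψ' ∈ generalizedEigenspace k ε x₀ h0 h1 μ n, ∃ Φ' Φ : ℝ → ℂ,
        LegendreEq k x₀ Ψ' Φ' ∧ IsSolution k ε x₀ μ Φ' Ψ Φ}
      zero_mem' := ⟨0, Submodule.zero_mem _, 0, 0, LegendreEq.zero k x₀,
        IsSolution.zero k ε x₀ μ⟩
      add_mem' := by
        rintro a b ⟨p, hp, q, r, h, h'⟩ ⟨p', hp', q', r', s, s'⟩
        exact ⟨p + p', Submodule.add_mem _ hp hp', q + q', r + r', h.add h0 h1 s,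
          h'.add h0 h1 s'⟩
      smul_mem' := by
        rintro c a ⟨p, hp, q, r, h, h'⟩
        exact ⟨c • p, Submodule.smul_mem _ c hp, c • q, c • r, h.smul c, h'.smul c⟩ }

/-- The root space of `μ`: all generalized eigenfunctions. Its dimension is the algebraic
multiplicity of `μ`. -/
def rootSpace (k : ℤ) (ε x₀ : ℝ) (h0 : 0 < x₀) (h1 : x₀ < 1) (μ : ℂ) : Submodule ℂ (ℝ → ℂ) :=
  ⨆ n, generalizedEigenspace k ε x₀ h0 h1 μ n

end SphericalLayer

end

/-! Let `N` be the two-dimensional kernel of `L_k`. In the variable `artanh x` the operator becomes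
a multiple of `d²/ds² - k²`, so `N` is spanned by `evenSol` and `oddSol`. Let `G` be the Volterra
operator solving `L_k u = g` with zero Cauchy data at `-x₀`. By variation of constants, `Ψ = G Φ`
satisfies the two remaining boundary conditions at `x₀` exactly when `Φ` is orthogonal to `N` in
`L²`. The four conditions on `Ψ` thus become `Φ ⊥ N` (`LegendreEq.perp_of_memX₀`, `memX₀_stream`).

The vorticity carries no boundary condition, so `L_k Φ = μ Φ + F` says only that `Φ - G (μ Φ + F)`
lies in `N`. Applying the orthogonal projection `P` onto the complement of `N` turns the system into
`φ = μ T φ + R f` with `T = P G P` and `R = P G` (`exists_symmetric_operator`). `T` is compact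
because `G` has a continuous kernel. By Green's formula it is symmetric, and `⟪f, T f⟫` is minus the
energy of the stream function of `P f`.

The rest is spectral theory of `T`. The Fredholm alternative leaves only eigenvalues and gives a
bounded inverse elsewhere. Symmetry makes the eigenvalues real and isolated and excludes Jordan
chains, and the sign of the form makes them negative. For the multiplicity, `Φ` solves a
second-order equation with even coefficients: an even solution is fixed by its value at `0`, an odd
one by its derivative there, so each parity contributes at most one dimension
(`IsSolution.exists_smul_eq`). -/

noncomputable section

namespace SphericalLayer

/-! ### Absolutely continuous functions with a prescribed derivative -/

/-- `f` is absolutely continuous on `[a, b]`, with integrable derivative `f'` almost everywhere. -/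
structure HasACDeriv (f f' : ℝ → ℂ) (a b : ℝ) : Prop where
  ac : AbsolutelyContinuousOnInterval f a b
  int : IntervalIntegrable f' volume a b
  deriv : ∀ᵐ x, x ∈ uIcc a b → HasDerivAt f (f' x) x

theorem absolutelyContinuousOnInterval_const (c : ℂ) (a b : ℝ) :
    AbsolutelyContinuousOnInterval (fun _ => c) a b :=
  (LipschitzWith.const c).lipschitzOnWith.absolutelyContinuousOnInterval

theorem absolutelyContinuousOnInterval_primitive {f : ℝ → ℂ} {a b : ℝ}
    (hf : IntervalIntegrable f volume a b) :
    AbsolutelyContinuousOnInterval (fun x => ∫ t in a..x, f t) a b := by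
  have hre : IntervalIntegrable (fun t => (f t).re) volume a b :=
    ⟨hf.1.re, hf.2.re⟩
  have him : IntervalIntegrable (fun t => (f t).im) volume a b :=
    ⟨hf.1.im, hf.2.im⟩
  have h1 := (hre.absolutelyContinuousOnInterval_intervalIntegral (c := a) left_mem_uIcc).smul
    (absolutelyContinuousOnInterval_const 1 a b)
  have h2 := (him.absolutelyContinuousOnInterval_intervalIntegral (c := a) left_mem_uIcc).smul
    (absolutelyContinuousOnInterval_const Complex.I a b)
  have key : ∀ x ∈ uIcc a b, (∫ t in a..x, f t) =
      (∫ t in a..x, (f t).re) • (1 : ℂ) + (∫ t in a..x, (f t).im) • Complex.I := by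
    intro x hx
    have hfx : IntervalIntegrable f volume a x := hf.mono_set (uIcc_subset_uIcc_left hx)
    have e1 : (∫ t in a..x, (f t).re) = (∫ t in a..x, f t).re := by
      have := Complex.reCLM.intervalIntegral_comp_comm hfx
      simpa using this
    have e2 : (∫ t in a..x, (f t).im) = (∫ t in a..x, f t).im := by
      have := Complex.imCLM.intervalIntegral_comp_comm hfx
      simpa using this
    rw [e1, e2]
    simp [Complex.re_add_im]
  have h := h1.add h2
  rw [absolutelyContinuousOnInterval_iff] at h ⊢
  intro ε hε
  obtain ⟨δ, hδ, H⟩ := h ε hε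
  refine ⟨δ, hδ, fun E hE hl => ?_⟩
  refine lt_of_eq_of_lt (Finset.sum_congr rfl fun i hi => ?_) (H E hE hl)
  have := hE.1 i hi
  rw [key _ this.1, key _ this.2]
  rfl

namespace HasACDeriv

variable {f f' g g' : ℝ → ℂ} {a b : ℝ}

theorem const (c : ℂ) (a b : ℝ) : HasACDeriv (fun _ => c) (fun _ => 0) a b :=
  ⟨absolutelyContinuousOnInterval_const c a b, intervalIntegrable_const,
    Filter.Eventually.of_forall fun x _ => hasDerivAt_const x c⟩

theorem mul (hf : HasACDeriv f f' a b) (hg : HasACDeriv g g' a b) :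
    HasACDeriv (fun x => f x * g x) (fun x => f' x * g x + f x * g' x) a b := by
  refine ⟨hf.ac.smul hg.ac, (hf.int.mul_continuousOn hg.ac.continuousOn).add
    (hg.int.continuousOn_mul hf.ac.continuousOn), ?_⟩
  filter_upwards [hf.deriv, hg.deriv] with x h1 h2 hx
  exact (h1 hx).mul (h2 hx)

theorem add (hf : HasACDeriv f f' a b) (hg : HasACDeriv g g' a b) :
    HasACDeriv (fun x => f x + g x) (fun x => f' x + g' x) a b := by
  refine ⟨hf.ac.add hg.ac, hf.int.add hg.int, ?_⟩
  filter_upwards [hf.deriv, hg.deriv] with x h1 h2 hx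
  exact (h1 hx).add (h2 hx)

theorem sub (hf : HasACDeriv f f' a b) (hg : HasACDeriv g g' a b) :
    HasACDeriv (fun x => f x - g x) (fun x => f' x - g' x) a b := by
  refine ⟨hf.ac.sub hg.ac, hf.int.sub hg.int, ?_⟩
  filter_upwards [hf.deriv, hg.deriv] with x h1 h2 hx
  exact (h1 hx).sub (h2 hx)

theorem const_mul (c : ℂ) (hf : HasACDeriv f f' a b) :
    HasACDeriv (fun x => c * f x) (fun x => c * f' x) a b := by
  simpa using (const c a b).mul hf

theorem star (hf : HasACDeriv f f' a b) :
    HasACDeriv (fun x => (starRingEnd ℂ) (f x)) (fun x => (starRingEnd ℂ) (f' x)) a b := by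
  refine ⟨?_, ?_, ?_⟩
  · have := hf.ac
    rw [absolutelyContinuousOnInterval_iff] at this ⊢
    simpa only [Complex.dist_conj_conj] using this
  · have h := hf.int
    exact ⟨(Complex.conjCLE : ℂ →L[ℝ] ℂ).integrable_comp h.1,
      (Complex.conjCLE : ℂ →L[ℝ] ℂ).integrable_comp h.2⟩
  · filter_upwards [hf.deriv] with x h hx
    exact (Complex.conjCLE : ℂ →L[ℝ] ℂ).hasFDerivAt.comp_hasDerivAt x (h hx)

theorem congr_deriv (hf : HasACDeriv f f' a b) (h : ∀ x ∈ uIcc a b, f' x = g' x) :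
    HasACDeriv f g' a b := by
  refine ⟨hf.ac, hf.int.congr fun x hx => h x (uIoc_subset_uIcc hx), ?_⟩
  filter_upwards [hf.deriv] with x h1 hx
  rw [← h x hx]
  exact h1 hx

theorem congr (hf : HasACDeriv f f' a b) (h : ∀ x ∈ uIcc a b, g x = f x) :
    HasACDeriv g f' a b := by
  refine ⟨?_, hf.int, ?_⟩
  · have := hf.ac
    rw [absolutelyContinuousOnInterval_iff] at this ⊢
    intro ε hε
    obtain ⟨δ, hδ, H⟩ := this ε hε
    refine ⟨δ, hδ, fun E hE hl => ?_⟩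
    refine lt_of_eq_of_lt (Finset.sum_congr rfl fun i hi => ?_) (H E hE hl)
    rw [h _ (hE.1 i hi).1, h _ (hE.1 i hi).2]
  · have h₁ : ∀ᵐ x : ℝ, x ≠ min a b := by simp [ae_iff, measure_singleton]
    have h₂ : ∀ᵐ x : ℝ, x ≠ max a b := by simp [ae_iff, measure_singleton]
    filter_upwards [hf.deriv, h₁, h₂] with x h3 h4 h5 hx
    refine (h3 hx).congr_of_eventuallyEq ?_
    have : uIcc a b ∈ nhds x :=
      Icc_mem_nhds (lt_of_le_of_ne hx.1 (Ne.symm h4)) (lt_of_le_of_ne hx.2 h5)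
    filter_upwards [this] with y hy using h y hy

theorem primitive (C : ℂ) (hf : IntervalIntegrable f volume a b) :
    HasACDeriv (fun x => C + ∫ t in a..x, f t) f a b := by
  refine ⟨(absolutelyContinuousOnInterval_const C a b).add
    (absolutelyContinuousOnInterval_primitive hf), hf, ?_⟩
  filter_upwards [hf.ae_hasDerivAt_integral] with x h hx
  exact (h hx a left_mem_uIcc).const_add C

theorem eq_of_deriv_eq_zero (hf : HasACDeriv f (fun _ => 0) a b) {x : ℝ} (hx : x ∈ uIcc a b) :
    f x = f a := by
  obtain ⟨C, hC⟩ := hf.ac.const_of_ae_hasDerivAt_zero hf.deriv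
  rw [hC x hx, hC a left_mem_uIcc]

/-- Subtracting the primitive of `f'` leaves an absolutely continuous function with zero derivative
almost everywhere, which is constant. -/
theorem eq_add_integral (hf : HasACDeriv f f' a b) {x : ℝ} (hx : x ∈ uIcc a b) :
    f x = f a + ∫ t in a..x, f' t := by
  have h := (hf.sub (primitive 0 hf.int)).congr_deriv (g' := fun _ => 0) (fun x _ => sub_self _)
  have := h.eq_of_deriv_eq_zero hx
  simp only [zero_add, intervalIntegral.integral_same, sub_zero] at this
  rw [← this]; ring

theorem of_hasDerivWithinAt (hab : a ≤ b) (h : ∀ x ∈ Icc a b, HasDerivWithinAt f (f' x) (Icc a b) x)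
    (hc : ContinuousOn f' (Icc a b)) : HasACDeriv f f' a b := by
  refine ⟨?_, ?_, ?_⟩
  · obtain ⟨C, hC⟩ := isCompact_Icc.exists_bound_of_continuousOn hc
    have : LipschitzOnWith C.toNNReal f (Icc a b) := by
      refine (convex_Icc a b).lipschitzOnWith_of_nnnorm_hasDerivWithin_le h fun x hx => ?_
      rw [← NNReal.coe_le_coe, coe_nnnorm]
      exact (hC x hx).trans (Real.le_coe_toNNReal C)
    rw [← uIcc_of_le hab] at this
    exact this.absolutelyContinuousOnInterval
  · rw [← uIcc_of_le hab] at hc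
    exact hc.intervalIntegrable
  · have h₁ : ∀ᵐ x : ℝ, x ≠ a := by simp [ae_iff, measure_singleton]
    have h₂ : ∀ᵐ x : ℝ, x ≠ b := by simp [ae_iff, measure_singleton]
    filter_upwards [h₁, h₂] with x h4 h5 hx
    rw [uIcc_of_le hab] at hx
    exact (h x hx).hasDerivAt
      (Icc_mem_nhds (lt_of_le_of_ne hx.1 (Ne.symm h4)) (lt_of_le_of_ne hx.2 h5))

/-- Upgrades the derivative from almost everywhere to everywhere, one-sidedly at the end points: `f`
is the primitive of a continuous function. -/
theorem hasDerivWithinAt (hab : a < b) (hf : HasACDeriv f f' a b) (hc : ContinuousOn f' (Icc a b))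
    {x : ℝ} (hx : x ∈ Icc a b) : HasDerivWithinAt f (f' x) (Icc a b) x := by
  have h : HasDerivWithinAt (fun y => f a + ∫ t in a..y, f' t) (f' x) (Icc a b) x := by
    refine HasDerivWithinAt.const_add _ ?_
    have : Fact (x ∈ Icc a b) := ⟨hx⟩
    refine intervalIntegral.integral_hasDerivWithinAt_right
      (hf.int.mono_set (uIcc_subset_uIcc_left (by rwa [uIcc_of_le hab.le]))) (t := Icc a b) ?_
      (hc x hx)
    exact hc.stronglyMeasurableAtFilter_nhdsWithin measurableSet_Icc x
  refine h.congr (fun y hy => ?_) ?_ <;> rw [← uIcc_of_le hab.le] at *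
  · exact hf.eq_add_integral hy
  · exact hf.eq_add_integral hx

theorem deriv_ae_eq_zero (hf : HasACDeriv f f' a b) (h : ∀ x ∈ uIcc a b, f x = f a) :
    ∀ᵐ x, x ∈ uIcc a b → f' x = 0 := by
  have h2 := (const (f a) a b).congr h
  filter_upwards [hf.deriv, h2.deriv] with x h3 h4 hx
  exact (h3 hx).unique (h4 hx)

end HasACDeriv

/-! ### The homogeneous solutions -/

/-- The even solution `cosh (k artanh x)` of `L_k u = 0`. -/
def evenSol (k : ℤ) (x : ℝ) : ℝ := Real.cosh (k * Real.artanh x)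

/-- The odd solution `sinh (k artanh x) / k` of `L_k u = 0`. -/
def oddSol (k : ℤ) (x : ℝ) : ℝ := Real.sinh (k * Real.artanh x) / k

theorem hasDerivAt_artanh {x : ℝ} (h : x ∈ Ioo (-1 : ℝ) 1) :
    HasDerivAt Real.artanh (1 / (1 - x ^ 2)) x := by
  have h1 : 0 < 1 + x := by linarith [h.1]
  have h2 : 0 < 1 - x := by linarith [h.2]
  have e : (fun y => 1 / 2 * (Real.log (1 + y) - Real.log (1 - y))) =ᶠ[nhds x] Real.artanh := by
    filter_upwards [Ioo_mem_nhds h.1 h.2] with y hy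
    rw [Real.artanh_eq_half_log (Ioo_subset_Icc_self hy),
      Real.log_div (by linarith [hy.1]) (by linarith [hy.2])]
  refine HasDerivAt.congr_of_eventuallyEq ?_ e.symm
  have d1 := ((hasDerivAt_id x).const_add 1).log h1.ne'
  have d2 := ((hasDerivAt_id x).const_sub 1).log h2.ne'
  refine ((d1.sub d2).const_mul (1 / 2)).congr_deriv ?_
  have : 1 - x ^ 2 ≠ 0 := by nlinarith
  simp only [id]
  field_simp
  ring

variable {k : ℤ} {x₀ : ℝ}

theorem one_sub_sq_pos (h1 : x₀ < 1) {x : ℝ} (hx : x ∈ Icc (-x₀) x₀) : 0 < 1 - x ^ 2 := by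
  nlinarith [hx.1, hx.2]

theorem mem_Ioo_one (h1 : x₀ < 1) {x : ℝ} (hx : x ∈ Icc (-x₀) x₀) : x ∈ Ioo (-1 : ℝ) 1 :=
  ⟨by linarith [hx.1], by linarith [hx.2]⟩

/-- With `c = evenSol k` and `s = oddSol k`, this and the next lemma give the first-order system `(1
- x²) c' = k² s`, `(1 - x²) s' = c`. -/
theorem hasDerivAt_evenSol (hk : k ≠ 0) {x : ℝ} (h : x ∈ Ioo (-1 : ℝ) 1) :
    HasDerivAt (evenSol k) ((k : ℝ) ^ 2 * oddSol k x / (1 - x ^ 2)) x := by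
  have hk' : (k : ℝ) ≠ 0 := Int.cast_ne_zero.2 hk
  refine ((hasDerivAt_artanh h).const_mul (k : ℝ)).cosh.congr_deriv ?_
  rw [oddSol]; field_simp

theorem hasDerivAt_oddSol (hk : k ≠ 0) {x : ℝ} (h : x ∈ Ioo (-1 : ℝ) 1) :
    HasDerivAt (oddSol k) (evenSol k x / (1 - x ^ 2)) x := by
  have hk' : (k : ℝ) ≠ 0 := Int.cast_ne_zero.2 hk
  refine (((hasDerivAt_artanh h).const_mul (k : ℝ)).sinh.div_const (k : ℝ)).congr_deriv ?_
  rw [evenSol]; field_simp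

/-- The left side is the weighted Wronskian `(1 - x²) (c s' - s c')`; its value `1` is why variation
of constants needs no normalizing factor. -/
theorem evenSol_sq_sub (hk : k ≠ 0) (x : ℝ) :
    evenSol k x ^ 2 - (k : ℝ) ^ 2 * oddSol k x ^ 2 = 1 := by
  have hk' : (k : ℝ) ≠ 0 := Int.cast_ne_zero.2 hk
  have := Real.cosh_sq_sub_sinh_sq (k * Real.artanh x)
  rw [evenSol, oddSol, div_pow]
  field_simp
  linarith

theorem continuousOn_evenSol (hk : k ≠ 0) (h1 : x₀ < 1) :
    ContinuousOn (evenSol k) (Icc (-x₀) x₀) := fun _ hx =>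
  (hasDerivAt_evenSol hk (mem_Ioo_one h1 hx)).continuousAt.continuousWithinAt

theorem continuousOn_oddSol (hk : k ≠ 0) (h1 : x₀ < 1) :
    ContinuousOn (oddSol k) (Icc (-x₀) x₀) := fun _ hx =>
  (hasDerivAt_oddSol hk (mem_Ioo_one h1 hx)).continuousAt.continuousWithinAt

theorem hasACDeriv_evenSol (hk : k ≠ 0) (h0 : 0 < x₀) (h1 : x₀ < 1) :
    HasACDeriv (fun x => (evenSol k x : ℂ))
      (fun x => (((k : ℝ) ^ 2 * oddSol k x / (1 - x ^ 2) : ℝ) : ℂ)) (-x₀) x₀ := by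
  refine HasACDeriv.of_hasDerivWithinAt (by linarith) (fun x hx =>
    (hasDerivAt_evenSol hk (mem_Ioo_one h1 hx)).ofReal_comp.hasDerivWithinAt) ?_
  refine Complex.continuous_ofReal.comp_continuousOn ?_
  exact ((continuousOn_oddSol hk h1).const_smul ((k : ℝ) ^ 2)).div (by fun_prop)
    fun x hx => (one_sub_sq_pos h1 hx).ne'

theorem hasACDeriv_oddSol (hk : k ≠ 0) (h0 : 0 < x₀) (h1 : x₀ < 1) :
    HasACDeriv (fun x => (oddSol k x : ℂ))
      (fun x => ((evenSol k x / (1 - x ^ 2) : ℝ) : ℂ)) (-x₀) x₀ := by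
  refine HasACDeriv.of_hasDerivWithinAt (by linarith) (fun x hx =>
    (hasDerivAt_oddSol hk (mem_Ioo_one h1 hx)).ofReal_comp.hasDerivWithinAt) ?_
  refine Complex.continuous_ofReal.comp_continuousOn ?_
  exact (continuousOn_evenSol hk h1).div (by fun_prop)
    fun x hx => (one_sub_sq_pos h1 hx).ne'

/-! ### The Legendre equation as a first order system -/

theorem LegendreEq.hasACDeriv_flux (h0 : 0 < x₀) (h1 : x₀ < 1) {u g : ℝ → ℂ}
    (H : LegendreEq k x₀ u g) :
    HasACDeriv (fun x => ((1 - x ^ 2 : ℝ) : ℂ) * derivWithin u (Icc (-x₀) x₀) x)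
      (fun t => g t + (((k : ℝ) ^ 2 / (1 - t ^ 2) : ℝ) : ℂ) * u t) (-x₀) x₀ := by
  refine (HasACDeriv.primitive (((1 - x₀ ^ 2 : ℝ) : ℂ) * derivWithin u (Icc (-x₀) x₀) (-x₀))
    (H.intervalIntegrable h1 ⟨by linarith, le_rfl⟩)).congr
    fun x hx => ?_
  rw [uIcc_of_le (by linarith)] at hx
  exact H.flux x hx

theorem LegendreEq.continuousOn_derivWithin (h0 : 0 < x₀) (h1 : x₀ < 1) {u g : ℝ → ℂ}
    (H : LegendreEq k x₀ u g) :
    ContinuousOn (derivWithin u (Icc (-x₀) x₀)) (Icc (-x₀) x₀) := by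
  have h := (H.hasACDeriv_flux h0 h1).ac.continuousOn
  rw [uIcc_of_le (by linarith)] at h
  have h2 : ContinuousOn (fun x : ℝ => ((1 - x ^ 2 : ℝ) : ℂ)) (Icc (-x₀) x₀) := by fun_prop
  have hp : ∀ x ∈ Icc (-x₀) x₀, ((1 - x ^ 2 : ℝ) : ℂ) ≠ 0 := fun x hx =>
    Complex.ofReal_ne_zero.2 (one_sub_sq_pos h1 hx).ne'
  refine (h.div h2 hp).congr fun x hx => ?_
  rw [Pi.div_apply, mul_div_cancel_left₀ _ (hp x hx)]

theorem LegendreEq.hasACDeriv (h0 : 0 < x₀) (h1 : x₀ < 1) {u g : ℝ → ℂ}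
    (H : LegendreEq k x₀ u g) :
    HasACDeriv u (derivWithin u (Icc (-x₀) x₀)) (-x₀) x₀ :=
  HasACDeriv.of_hasDerivWithinAt (by linarith)
    (fun x hx => (H.differentiableOn x hx).hasDerivWithinAt) (H.continuousOn_derivWithin h0 h1)

/-- Converse of the two preceding passages: a solution `(u, v)` of the first-order system solves the
Legendre equation, with `v` as its flux. -/
theorem legendreEq_of_hasACDeriv (h0 : 0 < x₀) (h1 : x₀ < 1) {u v g : ℝ → ℂ}
    (hg : MemLp g 2 (volume.restrict (Icc (-x₀) x₀)))
    (hu : HasACDeriv u (fun x => v x / ((1 - x ^ 2 : ℝ) : ℂ)) (-x₀) x₀)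
    (hv : HasACDeriv v (fun t => g t + (((k : ℝ) ^ 2 / (1 - t ^ 2) : ℝ) : ℂ) * u t) (-x₀) x₀) :
    LegendreEq k x₀ u g ∧
      ∀ x ∈ Icc (-x₀) x₀, ((1 - x ^ 2 : ℝ) : ℂ) * derivWithin u (Icc (-x₀) x₀) x = v x := by
  have hlt : -x₀ < x₀ := by linarith
  have hp : ∀ x ∈ Icc (-x₀) x₀, ((1 - x ^ 2 : ℝ) : ℂ) ≠ 0 := fun x hx =>
    Complex.ofReal_ne_zero.2 (one_sub_sq_pos h1 hx).ne'
  have hc : ContinuousOn (fun x => v x / ((1 - x ^ 2 : ℝ) : ℂ)) (Icc (-x₀) x₀) := by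
    have h := hv.ac.continuousOn
    rw [uIcc_of_le hlt.le] at h
    exact h.div (by fun_prop) hp
  have hd : ∀ x ∈ Icc (-x₀) x₀, HasDerivWithinAt u (v x / ((1 - x ^ 2 : ℝ) : ℂ))
      (Icc (-x₀) x₀) x := fun x hx => hu.hasDerivWithinAt hlt hc hx
  have hd' : ∀ x ∈ Icc (-x₀) x₀,
      ((1 - x ^ 2 : ℝ) : ℂ) * derivWithin u (Icc (-x₀) x₀) x = v x := fun x hx => by
    rw [(hd x hx).derivWithin (uniqueDiffOn_Icc hlt x hx), mul_div_cancel₀ _ (hp x hx)]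
  refine ⟨⟨fun x hx => (hd x hx).differentiableWithinAt, hg, fun x hx => ?_⟩, hd'⟩
  have hl := hd' _ (left_mem_Icc.2 hlt.le)
  rw [neg_sq] at hl
  rw [hd' x hx, hl]
  exact hv.eq_add_integral (by rwa [uIcc_of_le hlt.le])

/-! ### Variation of constants -/

theorem MemLp.intervalIntegrable_mul {g : ℝ → ℂ} {φ : ℝ → ℝ}
    (h0 : 0 < x₀) (hg : MemLp g 2 (volume.restrict (Icc (-x₀) x₀)))
    (hφ : ContinuousOn φ (Icc (-x₀) x₀)) :
    IntervalIntegrable (fun t => (φ t : ℂ) * g t) volume (-x₀) x₀ := by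
  have hlt : -x₀ ≤ x₀ := by linarith
  have : IntervalIntegrable g volume (-x₀) x₀ := by
    rw [intervalIntegrable_iff_integrableOn_Icc_of_le hlt]
    exact hg.integrable (by norm_num)
  refine this.continuousOn_mul ?_
  rw [uIcc_of_le hlt]
  exact Complex.continuous_ofReal.comp_continuousOn hφ

/-- Variation of constants: the solution of `L_k u = g` with the parameters `a`, `b` multiplying the
odd and the (negative of the) even solution. -/
def solve (k : ℤ) (x₀ : ℝ) (a b : ℂ) (g : ℝ → ℂ) (x : ℝ) : ℂ :=
  oddSol k x * (a + ∫ t in (-x₀)..x, (evenSol k t : ℂ) * g t) -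
    evenSol k x * (b + ∫ t in (-x₀)..x, (oddSol k t : ℂ) * g t)

/-- The flux `(1 - x²) u'` of `u = solve k x₀ a b g`. -/
def solveFlux (k : ℤ) (x₀ : ℝ) (a b : ℂ) (g : ℝ → ℂ) (x : ℝ) : ℂ :=
  evenSol k x * (a + ∫ t in (-x₀)..x, (evenSol k t : ℂ) * g t) -
    (k : ℂ) ^ 2 * (oddSol k x * (b + ∫ t in (-x₀)..x, (oddSol k t : ℂ) * g t))

/-- Differentiating the two coefficients contributes `s c g - c s g = 0` to `u'`, and `(c² - k² s²)
g = g` to the derivative of the flux. -/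
theorem solve_spec (hk : k ≠ 0) (h0 : 0 < x₀) (h1 : x₀ < 1) (a b : ℂ) {g : ℝ → ℂ}
    (hg : MemLp g 2 (volume.restrict (Icc (-x₀) x₀))) :
    LegendreEq k x₀ (solve k x₀ a b g) g ∧ ∀ x ∈ Icc (-x₀) x₀,
      ((1 - x ^ 2 : ℝ) : ℂ) * derivWithin (solve k x₀ a b g) (Icc (-x₀) x₀) x =
        solveFlux k x₀ a b g x := by
  have hlt : -x₀ ≤ x₀ := by linarith
  have hA := HasACDeriv.primitive a (MemLp.intervalIntegrable_mul h0 hg (continuousOn_evenSol hk h1))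
  have hB := HasACDeriv.primitive b (MemLp.intervalIntegrable_mul h0 hg (continuousOn_oddSol hk h1))
  have hc := hasACDeriv_evenSol hk h0 h1
  have hs := hasACDeriv_oddSol hk h0 h1
  have hp : ∀ x ∈ uIcc (-x₀) x₀, (1 - (x : ℂ) ^ 2) ≠ 0 := fun x hx => by
    rw [uIcc_of_le hlt] at hx
    exact_mod_cast (one_sub_sq_pos h1 hx).ne'
  have hid : ∀ x, (evenSol k x : ℂ) ^ 2 - (k : ℂ) ^ 2 * (oddSol k x : ℂ) ^ 2 = 1 := fun x => by
    exact_mod_cast evenSol_sq_sub hk x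
  refine legendreEq_of_hasACDeriv h0 h1 hg ?_ ?_
  · refine ((hs.mul hA).sub (hc.mul hB)).congr_deriv fun x hx => ?_
    have := hp x hx
    simp only [solveFlux]
    push_cast
    field_simp
    ring
  · refine ((hc.mul hA).sub ((hs.mul hB).const_mul ((k : ℂ) ^ 2))).congr_deriv fun x hx => ?_
    have := hp x hx
    simp only [solve]
    push_cast
    field_simp
    linear_combination (1 - (x : ℂ) ^ 2) * g x * hid x

/-- Every solution of `L_k u = g` is given by variation of constants. -/
theorem LegendreEq.eq_solve (hk : k ≠ 0) (h0 : 0 < x₀) (h1 : x₀ < 1) {u g : ℝ → ℂ}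
    (H : LegendreEq k x₀ u g) : ∃ a b : ℂ,
      (u (-x₀) = 0 → derivWithin u (Icc (-x₀) x₀) (-x₀) = 0 → a = 0 ∧ b = 0) ∧
      (u x₀ = 0 → derivWithin u (Icc (-x₀) x₀) x₀ = 0 →
        a + (∫ t in (-x₀)..x₀, (evenSol k t : ℂ) * g t) = 0 ∧
        b + (∫ t in (-x₀)..x₀, (oddSol k t : ℂ) * g t) = 0) ∧
      ∀ x ∈ Icc (-x₀) x₀, u x = solve k x₀ a b g x := by
  have hlt : -x₀ ≤ x₀ := by linarith
  have hc := hasACDeriv_evenSol hk h0 h1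
  have hs := hasACDeriv_oddSol hk h0 h1
  have hu := H.hasACDeriv h0 h1
  have hv := H.hasACDeriv_flux h0 h1
  have hp : ∀ x ∈ uIcc (-x₀) x₀, (1 - (x : ℂ) ^ 2) ≠ 0 := fun x hx => by
    rw [uIcc_of_le hlt] at hx
    exact_mod_cast (one_sub_sq_pos h1 hx).ne'
  have hid : ∀ x, (evenSol k x : ℂ) ^ 2 - (k : ℂ) ^ 2 * (oddSol k x : ℂ) ^ 2 = 1 := fun x => by
    exact_mod_cast evenSol_sq_sub hk x
  -- With `v` the flux of `u`, the Wronskians `A = c v - k² s u` and `B = s v - c u` have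
  -- derivatives `c g` and `s g`. Their values at `-x₀` are the parameters `a` and `b`, and `u = s A
  -- - c B`.
  have hA := ((hc.mul hv).sub ((hs.mul hu).const_mul ((k : ℂ) ^ 2))).congr_deriv
    (g' := fun t => (evenSol k t : ℂ) * g t) fun x hx => by
      have := hp x hx
      push_cast
      field_simp
      ring
  have hB := ((hs.mul hv).sub (hc.mul hu)).congr_deriv
    (g' := fun t => (oddSol k t : ℂ) * g t) fun x hx => by
      have := hp x hx
      push_cast
      field_simp
      ring
  have hr : x₀ ∈ uIcc (-x₀) x₀ := right_mem_uIcc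
  refine ⟨evenSol k (-x₀) * (((1 - (-x₀) ^ 2 : ℝ) : ℂ) * derivWithin u (Icc (-x₀) x₀) (-x₀)) -
      (k : ℂ) ^ 2 * (oddSol k (-x₀) * u (-x₀)),
    oddSol k (-x₀) * (((1 - (-x₀) ^ 2 : ℝ) : ℂ) * derivWithin u (Icc (-x₀) x₀) (-x₀)) -
      evenSol k (-x₀) * u (-x₀), fun e1 e2 => ?_, fun e1 e2 => ?_, fun x hx => ?_⟩
  · rw [e1, e2]
    simp
  · rw [← hA.eq_add_integral hr, ← hB.eq_add_integral hr, e1, e2]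
    simp
  · rw [← uIcc_of_le hlt] at hx
    rw [solve, ← hA.eq_add_integral hx, ← hB.eq_add_integral hx]
    linear_combination -u x * hid x

/-! ### Green's formula -/

/-- Integration by parts of `conj u` against the flux of `v`. The boundary terms vanish because of
`u` alone, so `v` is unrestricted at the end points. -/
theorem LegendreEq.integral_star_mul (h0 : 0 < x₀) (h1 : x₀ < 1) {u v f g : ℝ → ℂ}
    (H : LegendreEq k x₀ u f) (H' : LegendreEq k x₀ v g) (hl : u (-x₀) = 0) (hr : u x₀ = 0) :
    ∫ x in (-x₀)..x₀, (starRingEnd ℂ) (u x) * g x =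
      -∫ x in (-x₀)..x₀, (((1 - x ^ 2 : ℝ) : ℂ) * ((starRingEnd ℂ) (derivWithin u (Icc (-x₀) x₀) x) *
          derivWithin v (Icc (-x₀) x₀) x) +
        (((k : ℝ) ^ 2 / (1 - x ^ 2) : ℝ) : ℂ) * ((starRingEnd ℂ) (u x) * v x)) := by
  have hlt : -x₀ ≤ x₀ := by linarith
  have hu := (H.hasACDeriv h0 h1).star
  have hv := H'.hasACDeriv_flux h0 h1
  have h := hu.mul hv
  have e := h.eq_add_integral right_mem_uIcc
  have hi : IntervalIntegrable (fun x => (starRingEnd ℂ) (u x) * g x) volume (-x₀) x₀ := by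
    refine IntervalIntegrable.continuousOn_mul ?_ hu.ac.continuousOn
    rw [intervalIntegrable_iff_integrableOn_Icc_of_le hlt]
    exact H'.memLp.integrable (by norm_num)
  rw [hl, hr] at e
  simp only [map_zero, zero_mul, zero_add] at e
  rw [← sub_eq_zero, sub_neg_eq_add]
  rw [e, ← intervalIntegral.integral_add hi]
  · refine intervalIntegral.integral_congr fun x _ => ?_
    ring
  · refine (h.int.sub hi).congr fun x _ => ?_
    ring

/-- The solution determines the right hand side. -/
theorem LegendreEq.ae_eq (h0 : 0 < x₀) (h1 : x₀ < 1) {u v f g : ℝ → ℂ}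
    (H : LegendreEq k x₀ u f) (H' : LegendreEq k x₀ v g) (h : ∀ x ∈ Icc (-x₀) x₀, u x = v x) :
    f =ᵐ[volume.restrict (Icc (-x₀) x₀)] g := by
  have hlt : -x₀ ≤ x₀ := by linarith
  have hu := H.hasACDeriv_flux h0 h1
  have hv := H'.hasACDeriv_flux h0 h1
  -- The fluxes of `u` and `v` coincide, so the derivative `f - g + k² / (1 - x²) (u - v)` of their
  -- difference vanishes almost everywhere.
  have hd := (hu.sub hv).deriv_ae_eq_zero fun x hx => by
    rw [uIcc_of_le hlt] at hx
    rw [derivWithin_congr h (h x hx), derivWithin_congr h (h (-x₀) ⟨le_rfl, hlt⟩), sub_self,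
      sub_self]
  rw [Filter.EventuallyEq, ae_restrict_iff' measurableSet_Icc]
  filter_upwards [hd] with x hx hx'
  have := hx (by rwa [uIcc_of_le hlt])
  rw [h x hx'] at this
  linear_combination this

theorem LegendreEq.congr_ae {u g h : ℝ → ℂ} (H : LegendreEq k x₀ u g)
    (e : h =ᵐ[volume.restrict (Icc (-x₀) x₀)] g) : LegendreEq k x₀ u h := by
  refine ⟨H.differentiableOn, (memLp_congr_ae e).2 H.memLp, fun x hx => ?_⟩
  rw [H.flux x hx]
  congr 1
  refine intervalIntegral.integral_congr_ae ?_
  rw [Filter.EventuallyEq, ae_restrict_iff' measurableSet_Icc] at e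
  filter_upwards [e] with t ht htx
  rw [uIoc_of_le hx.1] at htx
  rw [ht ⟨htx.1.le, htx.2.trans hx.2⟩]

theorem LegendreEq.congr_left (h0 : 0 < x₀) {u v g : ℝ → ℂ} (H : LegendreEq k x₀ u g)
    (h : ∀ x ∈ Icc (-x₀) x₀, v x = u x) : LegendreEq k x₀ v g := by
  refine ⟨H.differentiableOn.congr h, H.memLp, fun x hx => ?_⟩
  rw [derivWithin_congr h (h x hx), derivWithin_congr h (h (-x₀) ⟨le_rfl, by linarith⟩),
    H.flux x hx]
  congr 1
  refine intervalIntegral.integral_congr fun t ht => ?_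
  rw [uIcc_of_le hx.1] at ht
  simp only [h t ⟨ht.1, ht.2.trans hx.2⟩]

/-! ### Compact operators -/

section Abstract

open scoped InnerProductSpace BoundedContinuousFunction

variable {E : Type*} [NormedAddCommGroup E] [InnerProductSpace ℂ E]

/-- The operator `f ↦ (x ↦ ⟪K x, f⟫)` from a Hilbert space to continuous functions on a compact
space. -/
def kernelOperator {X : Type*} [TopologicalSpace X] [CompactSpace X] (K : C(X, E)) :
    E →L[ℂ] (X →ᵇ ℂ) :=
  LinearMap.mkContinuous
    { toFun := fun f => BoundedContinuousFunction.mkOfCompact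
        ⟨fun x => ⟪K x, f⟫_ℂ, K.continuous.inner continuous_const⟩
      map_add' := fun f g => by ext x; exact inner_add_right _ _ _
      map_smul' := fun c f => by ext x; exact inner_smul_right _ _ _ }
    ‖BoundedContinuousFunction.mkOfCompact K‖ fun f => by
      refine (BoundedContinuousFunction.norm_le (by positivity)).2 fun x => ?_
      exact (norm_inner_le_norm _ _).trans (mul_le_mul_of_nonneg_right
        ((BoundedContinuousFunction.mkOfCompact K).norm_coe_le_norm x) (norm_nonneg f))

theorem kernelOperator_apply {X : Type*} [TopologicalSpace X] [CompactSpace X] (K : C(X, E))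
    (f : E) (x : X) : kernelOperator K f x = ⟪K x, f⟫_ℂ := rfl

/-- Arzelà–Ascoli: on the unit ball, Cauchy–Schwarz bounds the images by `sup ‖K‖` and their
increments by `‖K x - K y‖`. -/
theorem isCompactOperator_kernelOperator {X : Type*} [TopologicalSpace X] [CompactSpace X]
    (K : C(X, E)) : IsCompactOperator (kernelOperator K) := by
  refine (isCompactOperator_iff_isCompact_closure_image_closedBall
    (kernelOperator K).toLinearMap zero_lt_one).2 ?_
  refine BoundedContinuousFunction.arzela_ascoli
    (Metric.closedBall 0 ‖BoundedContinuousFunction.mkOfCompact K‖) (isCompact_closedBall _ _) _ ?_ ?_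
  · rintro _ x ⟨f, hf, rfl⟩
    rw [mem_closedBall_zero_iff] at hf ⊢
    refine (norm_inner_le_norm (K x) f).trans ?_
    exact (mul_le_of_le_one_right (norm_nonneg _) hf).trans
      ((BoundedContinuousFunction.mkOfCompact K).norm_coe_le_norm x)
  · intro x
    rw [Metric.equicontinuousAt_iff_right]
    intro ε hε
    filter_upwards [K.continuous.continuousAt (Metric.ball_mem_nhds (K x) hε)] with y hy
    rintro ⟨_, f, hf, rfl⟩
    rw [mem_closedBall_zero_iff] at hf
    have e : dist (kernelOperator K f x) (kernelOperator K f y) = ‖⟪K x - K y, f⟫_ℂ‖ := by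
      rw [dist_eq_norm, kernelOperator_apply, kernelOperator_apply, inner_sub_left]
    refine e.trans_lt ((norm_inner_le_norm _ _).trans_lt ?_)
    rw [← dist_eq_norm, dist_comm]
    exact (mul_le_of_le_one_right dist_nonneg hf).trans_lt hy

variable {T : E →L[ℂ] E}

/-- The Fredholm alternative for `T` at the point `μ⁻¹`; `μ = 0` is trivial. -/
theorem isUnit_one_sub_smul [CompleteSpace E] (hT : IsCompactOperator T) {μ : ℂ} (h : ∀ v, v = μ • T v → v = 0) :
    IsUnit (1 - μ • T) := by
  rcases eq_or_ne μ 0 with rfl | hμ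
  · simp
  have h2 := (hT.hasEigenvalue_or_mem_resolventSet (inv_ne_zero hμ)).resolve_left fun hev => by
    obtain ⟨v, hv⟩ := hev.exists_hasEigenvector
    refine hv.2 (h v ?_)
    have := hv.apply_eq_smul
    simp only [ContinuousLinearMap.coe_coe] at this
    rw [this, smul_smul, mul_inv_cancel₀ hμ, one_smul]
  rw [spectrum.mem_resolventSet_iff] at h2
  have e : 1 - μ • T = (Units.mk0 μ hμ) • (algebraMap ℂ (E →L[ℂ] E) μ⁻¹ - T) := by
    rw [Units.smul_mk0, smul_sub, Algebra.algebraMap_eq_smul_one, smul_smul, mul_inv_cancel₀ hμ,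
      one_smul]
  rw [e]
  exact h2.smul _

/-- Substituting `μ • T v` for `v` in either slot of `⟪v, v⟫ ≠ 0` gives `μ` or its conjugate times
the same number `⟪v, T v⟫`. -/
theorem conj_eq_of_eq_smul (hs : ∀ f g, ⟪T f, g⟫_ℂ = ⟪f, T g⟫_ℂ) {μ : ℂ} {v : E} (hv : v ≠ 0)
    (h : v = μ • T v) : (starRingEnd ℂ) μ = μ := by
  have h1 : ⟪v, v⟫_ℂ = μ * ⟪v, T v⟫_ℂ := by
    rw [← inner_smul_right, ← h]
  have h2 : ⟪v, v⟫_ℂ = (starRingEnd ℂ) μ * ⟪v, T v⟫_ℂ := by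
    rw [← hs, ← inner_smul_left, ← h]
  have h3 : ⟪v, T v⟫_ℂ ≠ 0 := fun h0 => hv (inner_self_eq_zero.1 (by rw [h1, h0, mul_zero]))
  exact mul_right_cancel₀ h3 (h2.symm.trans h1)

/-- Eigenvalues of compact symmetric operators are isolated. -/
theorem exists_forall_dist_lt [CompleteSpace E] (hT : IsCompactOperator T) (hs : ∀ f g, ⟪T f, g⟫_ℂ = ⟪f, T g⟫_ℂ)
    {μ : ℂ} (hμ : (starRingEnd ℂ) μ = μ) :
    ∃ δ > 0, ∀ μ' : ℂ, dist μ' μ < δ → μ' ≠ μ → ∀ v, v = μ' • T v → v = 0 := by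
  -- The idea is to remove the eigenspace `N` from `T`. Then `1 - μ T'` is invertible and stays so
  -- near `μ`, while eigenvectors for any other `μ'` are orthogonal to `N`, where `T'` and `T`
  -- agree.
  let N : Submodule ℂ E := (1 - μ • T).ker
  have hN : ∀ w, w ∈ N ↔ w = μ • T w := fun w => by
    simp [N, LinearMap.mem_ker, sub_eq_zero]
  have : CompleteSpace N := (1 - μ • T).isClosed_ker.completeSpace_coe
  let T' : E →L[ℂ] E := T ∘L Nᗮ.starProjection
  have hT' : IsCompactOperator T' := hT.comp_clm _
  have hu : IsUnit (1 - μ • T') := by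
    refine isUnit_one_sub_smul hT' fun v hv => ?_
    -- For `w ∈ N`, symmetry moves `μ T` onto `w` and reproduces `w`, so `⟪w, v⟫ = ⟪w, Q v⟫ = 0`
    -- with `Q` the projection onto `Nᗮ`. Hence `T' v = T v`, so `v` also lies in `N`.
    have h1 : v ∈ Nᗮ := by
      rw [Submodule.mem_orthogonal]
      intro w hw
      have e : ⟪w, v⟫_ℂ = ⟪w, Nᗮ.starProjection v⟫_ℂ := by
        conv_lhs => rw [hv]
        conv_rhs => rw [(hN w).1 hw]
        rw [inner_smul_left, inner_smul_right, hμ, hs]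
        rfl
      rw [e]
      exact (Submodule.mem_orthogonal _ _).1 (Submodule.starProjection_apply_mem _ _) w hw
    have h2 : Nᗮ.starProjection v = v := Submodule.starProjection_eq_self_iff.2 h1
    have h3 : v ∈ N := by
      rw [hN]
      conv_lhs => rw [hv]
      change μ • T (Nᗮ.starProjection v) = _
      rw [h2]
    exact inner_self_eq_zero.1 ((Submodule.mem_orthogonal _ _).1 h1 v h3)
  have hc : Continuous fun z : ℂ => 1 - z • T' := by fun_prop
  obtain ⟨δ, hδ, H⟩ := Metric.isOpen_iff.1 (Units.isOpen.preimage hc) μ hu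
  refine ⟨δ, hδ, fun μ' hd hne v hv => ?_⟩
  by_contra hv0
  have hμ' := conj_eq_of_eq_smul hs hv0 hv
  have h1 : v ∈ Nᗮ := by
    rw [Submodule.mem_orthogonal]
    intro w hw
    have e1 : ⟪w, v⟫_ℂ = μ' * ⟪w, T v⟫_ℂ := by rw [← inner_smul_right, ← hv]
    have e2 : ⟪w, v⟫_ℂ = μ * ⟪w, T v⟫_ℂ := by
      conv_lhs => rw [(hN w).1 hw, inner_smul_left, hμ, hs]
    have e3 : (μ' - μ) * ⟪w, T v⟫_ℂ = 0 := by rw [sub_mul, ← e1, ← e2, sub_self]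
    rw [e1, (mul_eq_zero.1 e3).resolve_left (sub_ne_zero.2 hne), mul_zero]
  have h2 : Nᗮ.starProjection v = v := Submodule.starProjection_eq_self_iff.2 h1
  have h3 : (1 - μ' • T') v = 0 := by
    change v - μ' • T (Nᗮ.starProjection v) = 0
    rw [h2, ← hv, sub_self]
  have hb := (ContinuousLinearMap.isUnit_iff_bijective.1 (H hd)).1
  exact hv0 (hb (by rw [h3, map_zero]))

/-- There are no Jordan chains for a symmetric operator. -/
theorem eq_zero_of_chain (hs : ∀ f g, ⟪T f, g⟫_ℂ = ⟪f, T g⟫_ℂ) {μ : ℂ} {v w : E}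
    (hv : v = μ • T v) (hw : w = μ • T w + T v) : v = 0 := by
  by_contra hv0
  have hμ := conj_eq_of_eq_smul hs hv0 hv
  have e1 : ⟪v, w⟫_ℂ = μ * ⟪v, T w⟫_ℂ + ⟪v, T v⟫_ℂ := by
    conv_lhs => rw [hw, inner_add_right, inner_smul_right]
  have e2 : ⟪v, w⟫_ℂ = μ * ⟪v, T w⟫_ℂ := by
    conv_lhs => rw [hv, inner_smul_left, hμ, hs]
  -- Pairing the chain relation with `v` forces this, and `⟪v, v⟫` is a multiple of it.
  have e3 : ⟪v, T v⟫_ℂ = 0 := by linear_combination e2 - e1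
  apply hv0
  rw [← inner_self_eq_zero (𝕜 := ℂ)]
  conv_lhs => arg 2; rw [hv]
  rw [inner_smul_left, hs, e3, mul_zero]

end Abstract

/-! ### The Volterra operator and the orthogonal projection in `L²(-x₀, x₀)` -/

section Concrete

open scoped InnerProductSpace BoundedContinuousFunction

/-- The Hilbert space `L²(-x₀, x₀)`. -/
abbrev LTwo (x₀ : ℝ) := Lp ℂ 2 (volume.restrict (Icc (-x₀) x₀))

theorem inner_eq_intervalIntegral (h0 : 0 < x₀) (f g : LTwo x₀) :
    ⟪f, g⟫_ℂ = ∫ x in (-x₀)..x₀, (starRingEnd ℂ) (f x) * g x := by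
  rw [L2.inner_def, intervalIntegral.integral_of_le (by linarith), ← integral_Icc_eq_integral_Ioc]
  refine integral_congr_ae (Filter.Eventually.of_forall fun x => ?_)
  simp only [RCLike.inner_apply]
  ring

theorem intervalIntegral_congr_restrict {f g : ℝ → ℂ}
    (h : f =ᵐ[volume.restrict (Icc (-x₀) x₀)] g) {x : ℝ} (hx : x ∈ Icc (-x₀) x₀) :
    ∫ t in (-x₀)..x, f t = ∫ t in (-x₀)..x, g t := by
  refine intervalIntegral.integral_congr_ae ?_
  rw [Filter.EventuallyEq, ae_restrict_iff' measurableSet_Icc] at h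
  filter_upwards [h] with t ht htx
  rw [uIoc_of_le hx.1] at htx
  exact ht ⟨htx.1.le, htx.2.trans hx.2⟩

/-- A continuous function on the interval, as an element of `L²`. -/
def continuousToLTwo (h0 : 0 < x₀) : (Icc (-x₀) x₀ →ᵇ ℂ) →L[ℂ] LTwo x₀ where
  toFun f := BoundedContinuousFunction.toLp (E := ℂ) 2 (volume.restrict (Icc (-x₀) x₀)) ℂ
    (f.compContinuous ⟨projIcc (-x₀) x₀ (by linarith), continuous_projIcc⟩)
  map_add' f g := by
    rw [← map_add]; rfl
  map_smul' c f := by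
    rw [RingHom.id_apply, ← map_smul]; rfl
  cont := (BoundedContinuousFunction.toLp (E := ℂ) 2 _ ℂ).continuous.comp
    (BoundedContinuousFunction.continuous_compContinuous _)

theorem continuousToLTwo_ae (h0 : 0 < x₀) (f : Icc (-x₀) x₀ →ᵇ ℂ) :
    continuousToLTwo h0 f =ᵐ[volume.restrict (Icc (-x₀) x₀)]
      fun t => f (projIcc (-x₀) x₀ (by linarith) t) :=
  BoundedContinuousFunction.coeFn_toLp (p := 2) (𝕜 := ℂ) (volume.restrict (Icc (-x₀) x₀)) _

/-- The kernel `sinh (k (artanh x - artanh t)⁺) / k` of the solution operator with zero initial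
data. -/
def kernelFun (k : ℤ) (x₀ : ℝ) (h1 : x₀ < 1) : C(Icc (-x₀) x₀ × Icc (-x₀) x₀, ℂ) where
  -- The `max` truncates the kernel to `t ≤ x`; since `sinh 0 = 0`, it remains continuous across the
  -- diagonal.
  toFun p := ((Real.sinh (k * max 0 (Real.artanh p.1 - Real.artanh p.2)) / k : ℝ) : ℂ)
  continuous_toFun := by
    have h : Continuous fun x : Icc (-x₀) x₀ => Real.artanh x :=
      continuous_iff_continuousAt.2 fun x =>
        (hasDerivAt_artanh (mem_Ioo_one h1 x.2)).continuousAt.comp continuous_subtype_val.continuousAt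
    have h2 := h.comp (continuous_fst (X := Icc (-x₀) x₀) (Y := Icc (-x₀) x₀))
    have h3 := h.comp (continuous_snd (X := Icc (-x₀) x₀) (Y := Icc (-x₀) x₀))
    exact Complex.continuous_ofReal.comp ((Real.continuous_sinh.comp
      (continuous_const.mul (continuous_const.max (h2.sub h3)))).div_const _)

/-- The kernel as a continuous map into `L²`. -/
def kernelLTwo (k : ℤ) (h0 : 0 < x₀) (h1 : x₀ < 1) : C(Icc (-x₀) x₀, LTwo x₀) where
  toFun x := continuousToLTwo h0 (BoundedContinuousFunction.mkOfCompact ((kernelFun k x₀ h1).curry x))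
  continuous_toFun := (continuousToLTwo h0).continuous.comp
    ((ContinuousMap.linearIsometryBoundedOfCompact (Icc (-x₀) x₀) ℂ ℂ).continuous.comp
      (kernelFun k x₀ h1).curry.continuous)

/-- The solution operator of `L_k u = g` with zero initial data at `-x₀`. -/
def solutionOperator (k : ℤ) (h0 : 0 < x₀) (h1 : x₀ < 1) : LTwo x₀ →L[ℂ] LTwo x₀ :=
  continuousToLTwo h0 ∘L kernelOperator (kernelLTwo k h0 h1)

theorem isCompactOperator_solutionOperator (h0 : 0 < x₀) (h1 : x₀ < 1) :
    IsCompactOperator (solutionOperator k h0 h1) :=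
  (isCompactOperator_kernelOperator _).clm_comp (continuousToLTwo h0)

/-- The addition formula for `sinh` writes the kernel for `t ≤ x` as `s(x) c(t) - c(x) s(t)`, the
integrand of variation of constants. It is real, so the conjugation in the inner product has no
effect. -/
theorem kernelOperator_kernelLTwo (hk : k ≠ 0) (h0 : 0 < x₀) (h1 : x₀ < 1) (f : LTwo x₀)
    (x : Icc (-x₀) x₀) :
    kernelOperator (kernelLTwo k h0 h1) f x = solve k x₀ 0 0 f x := by
  have hk' : (k : ℂ) ≠ 0 := Int.cast_ne_zero.2 hk
  have hlt : -x₀ ≤ x₀ := by linarith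
  have hx := x.2
  have hc := MemLp.intervalIntegrable_mul h0 (Lp.memLp f) (continuousOn_evenSol hk h1)
  have hs := MemLp.intervalIntegrable_mul h0 (Lp.memLp f) (continuousOn_oddSol hk h1)
  have hsub : uIcc (-x₀) (x : ℝ) ⊆ uIcc (-x₀) x₀ :=
    uIcc_subset_uIcc_left (by rw [uIcc_of_le hlt]; exact hx)
  let r : ℝ → ℂ := fun t => (oddSol k x : ℂ) * ((evenSol k t : ℂ) * f t) -
    (evenSol k x : ℂ) * ((oddSol k t : ℂ) * f t)
  have hr : IntervalIntegrable r volume (-x₀) x₀ := (hc.const_mul _).sub (hs.const_mul _)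
  have hK : ∀ t : ℝ, t ∈ Icc (-x₀) x₀ →
      kernelFun k x₀ h1 (x, projIcc (-x₀) x₀ hlt t) * f t = if t ≤ x then r t else 0 := by
    intro t ht
    rw [projIcc_of_mem hlt ht]
    change ((Real.sinh (k * max 0 (Real.artanh x - Real.artanh t)) / k : ℝ) : ℂ) * f t = _
    split_ifs with htx
    · have := (Real.artanh_le_artanh_iff (mem_Ioo_one h1 ht) (mem_Ioo_one h1 hx)).2 htx
      rw [max_eq_right (by linarith), mul_sub, Real.sinh_sub]
      simp only [r, oddSol, evenSol]
      push_cast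
      field_simp
    · have := (Real.artanh_le_artanh_iff (mem_Ioo_one h1 hx) (mem_Ioo_one h1 ht)).2
        (not_le.1 htx).le
      rw [max_eq_left (by linarith)]
      simp
  have e : kernelOperator (kernelLTwo k h0 h1) f x =
      ∫ t in (-x₀)..x₀, if t ≤ x then r t else 0 := by
    rw [kernelOperator_apply, inner_eq_intervalIntegral h0]
    have hae := continuousToLTwo_ae h0
      (BoundedContinuousFunction.mkOfCompact ((kernelFun k x₀ h1).curry x))
    refine intervalIntegral_congr_restrict ?_ ⟨hlt, le_rfl⟩
    filter_upwards [hae, ae_restrict_mem measurableSet_Icc] with t ht htm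
    change (starRingEnd ℂ) (continuousToLTwo h0 _ t) * _ = _
    rw [ht, ← hK t htm]
    congr 1
    exact Complex.conj_ofReal _
  have i1 : ∫ t in (-x₀)..x, (if t ≤ x then r t else 0) = ∫ t in (-x₀)..x, r t := by
    refine intervalIntegral.integral_congr fun t ht => ?_
    rw [uIcc_of_le hx.1] at ht
    exact if_pos ht.2
  have i2 : ∀ t ∈ uIoc (x : ℝ) x₀, 0 = (if t ≤ (x : ℝ) then r t else 0) := by
    intro t ht
    rw [uIoc_of_le hx.2] at ht
    exact (if_neg (not_le.2 ht.1)).symm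
  have i3 : ∀ t ∈ uIoc (-x₀) (x : ℝ), r t = (if t ≤ (x : ℝ) then r t else 0) := by
    intro t ht
    rw [uIoc_of_le hx.1] at ht
    exact (if_pos ht.2).symm
  have i4 : ∫ t in (x : ℝ)..x₀, (if t ≤ (x : ℝ) then r t else 0) = 0 := by
    rw [← intervalIntegral.integral_congr_ae (f := fun _ => (0 : ℂ))
      (Filter.Eventually.of_forall i2), intervalIntegral.integral_zero]
  rw [e, ← intervalIntegral.integral_add_adjacent_intervals (b := (x : ℝ))
    ((hr.mono_set hsub).congr i3) (intervalIntegrable_const.congr i2), i1,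
    i4, add_zero, intervalIntegral.integral_sub,
    intervalIntegral.integral_const_mul, intervalIntegral.integral_const_mul, solve, zero_add,
    zero_add]
  · exact ((hc.mono_set hsub).const_mul _)
  · exact ((hs.mono_set hsub).const_mul _)

theorem solutionOperator_ae (hk : k ≠ 0) (h0 : 0 < x₀) (h1 : x₀ < 1) (f : LTwo x₀) :
    solutionOperator k h0 h1 f =ᵐ[volume.restrict (Icc (-x₀) x₀)] solve k x₀ 0 0 f := by
  filter_upwards [continuousToLTwo_ae h0 (kernelOperator (kernelLTwo k h0 h1) f),
    ae_restrict_mem measurableSet_Icc] with t ht htm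
  refine ht.trans ?_
  rw [kernelOperator_kernelLTwo hk, projIcc_of_mem _ htm]

/-- Orthogonality to the solutions of `L_k u = 0`. -/
def Perp (k : ℤ) (x₀ : ℝ) (f : ℝ → ℂ) : Prop :=
  ∫ t in (-x₀)..x₀, (evenSol k t : ℂ) * f t = 0 ∧ ∫ t in (-x₀)..x₀, (oddSol k t : ℂ) * f t = 0

theorem Perp.congr_ae (h0 : 0 < x₀) {f g : ℝ → ℂ} (h : Perp k x₀ f)
    (e : f =ᵐ[volume.restrict (Icc (-x₀) x₀)] g) : Perp k x₀ g := by
  constructor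
  · rw [← h.1]
    exact intervalIntegral_congr_restrict (e.mono fun t ht => by simp only [ht])
      ⟨by linarith, le_rfl⟩
  · rw [← h.2]
    exact intervalIntegral_congr_restrict (e.mono fun t ht => by simp only [ht])
      ⟨by linarith, le_rfl⟩

/-- The orthogonal projection onto the complement of the solutions of `L_k u = 0`. -/
theorem exists_projection (hk : k ≠ 0) (h0 : 0 < x₀) (h1 : x₀ < 1) :
    ∃ P : LTwo x₀ →L[ℂ] LTwo x₀, (∀ f, Perp k x₀ (P f)) ∧ (∀ f : LTwo x₀, Perp k x₀ f → P f = f) ∧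
      (∀ f g, ⟪P f, g⟫_ℂ = ⟪f, P g⟫_ℂ) ∧
      (∀ (f : LTwo x₀) (a b : ℂ), f =ᵐ[volume.restrict (Icc (-x₀) x₀)]
        (fun t => a * oddSol k t + b * evenSol k t) → P f = 0) ∧
      ∀ f : LTwo x₀, ∃ a b : ℂ, P f =ᵐ[volume.restrict (Icc (-x₀) x₀)]
        (fun t => f t + (a * oddSol k t - b * evenSol k t)) := by
  have hmem : ∀ φ : ℝ → ℝ, ContinuousOn φ (Icc (-x₀) x₀) →
      MemLp (fun t => (φ t : ℂ)) 2 (volume.restrict (Icc (-x₀) x₀)) := fun φ hφ => by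
    obtain ⟨C, hC⟩ := isCompact_Icc.exists_bound_of_continuousOn hφ
    have hφ' := Complex.continuous_ofReal.comp_continuousOn hφ
    refine MemLp.of_bound (hφ'.aestronglyMeasurable measurableSet_Icc) C ?_
    filter_upwards [ae_restrict_mem measurableSet_Icc] with t ht
    rw [Complex.norm_real]
    exact hC t ht
  have hin : ∀ (φ : ℝ → ℝ) (hφ : ContinuousOn φ (Icc (-x₀) x₀)) (f : LTwo x₀),
      ⟪(hmem φ hφ).toLp, f⟫_ℂ = ∫ t in (-x₀)..x₀, (φ t : ℂ) * f t := fun φ hφ f => by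
    rw [inner_eq_intervalIntegral h0]
    refine intervalIntegral_congr_restrict ?_ ⟨by linarith, le_rfl⟩
    filter_upwards [(hmem φ hφ).coeFn_toLp] with t ht
    rw [ht, Complex.conj_ofReal]
  let c : LTwo x₀ := (hmem _ (continuousOn_evenSol hk h1)).toLp
  let s : LTwo x₀ := (hmem _ (continuousOn_oddSol hk h1)).toLp
  have hc : c =ᵐ[volume.restrict (Icc (-x₀) x₀)] fun t => (evenSol k t : ℂ) := MemLp.coeFn_toLp _
  have hs : s =ᵐ[volume.restrict (Icc (-x₀) x₀)] fun t => (oddSol k t : ℂ) := MemLp.coeFn_toLp _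
  let N : Submodule ℂ (LTwo x₀) := Submodule.span ℂ {s, c}
  have : FiniteDimensional ℂ N := FiniteDimensional.span_of_finite ℂ (by simp)
  have hperp : ∀ f : LTwo x₀, Perp k x₀ f ↔ f ∈ Nᗮ := fun f => by
    rw [Perp, ← hin _ (continuousOn_evenSol hk h1), ← hin _ (continuousOn_oddSol hk h1),
      Submodule.mem_orthogonal]
    constructor
    · rintro ⟨e1, e2⟩ u hu
      obtain ⟨a, b, rfl⟩ := Submodule.mem_span_pair.1 hu
      rw [inner_add_left, inner_smul_left, inner_smul_left, e1, e2]
      simp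
    · intro h
      exact ⟨h c (Submodule.subset_span (by simp)), h s (Submodule.subset_span (by simp))⟩
  refine ⟨Nᗮ.starProjection, fun f => (hperp _).2 (Submodule.starProjection_apply_mem _ _),
    fun f hf => Submodule.starProjection_eq_self_iff.2 ((hperp f).1 hf),
    fun f g => Submodule.inner_starProjection_left_eq_right _ f g, fun f a b hf => ?_, fun f => ?_⟩
  · have e : f = a • s + b • c := by
      refine Lp.ext ?_
      filter_upwards [hf, hs, hc, Lp.coeFn_add (a • s) (b • c), Lp.coeFn_smul a s,
        Lp.coeFn_smul b c] with t h1 h2 h3 h4 h5 h6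
      rw [h1, h4, Pi.add_apply, h5, h6, Pi.smul_apply, Pi.smul_apply, h2, h3, smul_eq_mul,
        smul_eq_mul]
    have hf : f ∈ N := by rw [e]; exact Submodule.mem_span_pair.2 ⟨a, b, rfl⟩
    rw [Submodule.starProjection_apply_eq_zero_iff, Submodule.orthogonal_orthogonal]
    exact hf
  · have h2 : f - Nᗮ.starProjection f ∈ N := by
      have := Submodule.sub_starProjection_mem_orthogonal (K := Nᗮ) f
      rwa [Submodule.orthogonal_orthogonal] at this
    obtain ⟨a, b, hab⟩ := Submodule.mem_span_pair.1 h2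
    refine ⟨-a, b, ?_⟩
    have e : Nᗮ.starProjection f = f - (a • s + b • c) := by rw [hab]; abel
    rw [e]
    filter_upwards [hs, hc, Lp.coeFn_sub f (a • s + b • c), Lp.coeFn_add (a • s) (b • c),
      Lp.coeFn_smul a s, Lp.coeFn_smul b c] with t h2 h3 h7 h4 h5 h6
    rw [h7, Pi.sub_apply, h4, Pi.add_apply, h5, h6, Pi.smul_apply, Pi.smul_apply, h2, h3,
      smul_eq_mul, smul_eq_mul]
    ring

end Concrete

section Bridge

open scoped InnerProductSpace

/-! ### The space `X₀` in terms of the solution operator -/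

/-- Zero Cauchy data at `-x₀` kill both constants in `solve`; zero data at `x₀` then say that the
two integrals over the whole interval vanish. -/
theorem LegendreEq.perp_of_memX₀ (hk : k ≠ 0) (h0 : 0 < x₀) (h1 : x₀ < 1) {Ψ Φ : ℝ → ℂ}
    (H : LegendreEq k x₀ Ψ Φ) (hΨ : MemX₀ k x₀ Ψ) :
    Perp k x₀ Φ ∧ ∀ x ∈ Icc (-x₀) x₀, Ψ x = solve k x₀ 0 0 Φ x := by
  have hlt : -x₀ < x₀ := by linarith
  obtain ⟨a, b, e1, e2, e3⟩ := H.eq_solve hk h0 h1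
  obtain ⟨rfl, rfl⟩ := e1 hΨ.left
    (hΨ.deriv_left.derivWithin (uniqueDiffOn_Icc hlt _ (left_mem_Icc.2 hlt.le)))
  have h2 := e2 hΨ.right
    (hΨ.deriv_right.derivWithin (uniqueDiffOn_Icc hlt _ (right_mem_Icc.2 hlt.le)))
  rw [zero_add, zero_add] at h2
  exact ⟨h2, e3⟩

/-- The stream function of a vorticity. -/
def stream (k : ℤ) (x₀ : ℝ) (Φ : ℝ → ℂ) : ℝ → ℂ := (Icc (-x₀) x₀).indicator (solve k x₀ 0 0 Φ)

theorem stream_congr_ae {f g : ℝ → ℂ} (e : f =ᵐ[volume.restrict (Icc (-x₀) x₀)] g) :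
    stream k x₀ f = stream k x₀ g := by
  refine indicator_congr fun x hx => ?_
  have e1 := intervalIntegral_congr_restrict (f := fun t => (evenSol k t : ℂ) * f t)
    (g := fun t => (evenSol k t : ℂ) * g t) (e.mono fun t ht => by simp only [ht]) hx
  have e2 := intervalIntegral_congr_restrict (f := fun t => (oddSol k t : ℂ) * f t)
    (g := fun t => (oddSol k t : ℂ) * g t) (e.mono fun t ht => by simp only [ht]) hx
  rw [solve, solve, e1, e2]

theorem LegendreEq.eq_stream (hk : k ≠ 0) (h0 : 0 < x₀) (h1 : x₀ < 1) {Ψ Φ : ℝ → ℂ}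
    (H : LegendreEq k x₀ Ψ Φ) (hΨ : MemX₀ k x₀ Ψ) : Ψ = stream k x₀ Φ := by
  ext x
  by_cases hx : x ∈ Icc (-x₀) x₀
  · rw [stream, indicator_of_mem hx, (H.perp_of_memX₀ hk h0 h1 hΨ).2 x hx]
  · rw [stream, indicator_of_notMem hx, hΨ.eq_zero_off x hx]

/-- The energy uses `deriv`, the equation `derivWithin`. They may differ at the end points, which
are null. -/
theorem energyDensity_eqOn (u : ℝ → ℂ) : EqOn (energyDensity k u)
    (fun x => (1 - x ^ 2) * ‖derivWithin u (Icc (-x₀) x₀) x‖ ^ 2 +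
      (k : ℝ) ^ 2 / (1 - x ^ 2) * ‖u x‖ ^ 2) (Ioo (-x₀) x₀) := fun x hx => by
  simp only [energyDensity]
  rw [derivWithin_of_mem_nhds (Icc_mem_nhds hx.1 hx.2)]

theorem LegendreEq.continuousOn_density (h0 : 0 < x₀) (h1 : x₀ < 1) {u g : ℝ → ℂ}
    (H : LegendreEq k x₀ u g) :
    ContinuousOn (fun x => (1 - x ^ 2) * ‖derivWithin u (Icc (-x₀) x₀) x‖ ^ 2 +
      (k : ℝ) ^ 2 / (1 - x ^ 2) * ‖u x‖ ^ 2) (Icc (-x₀) x₀) := by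
  have hd := H.continuousOn_derivWithin h0 h1
  have hu := H.differentiableOn.continuousOn
  have hw : ContinuousOn (fun x : ℝ => (k : ℝ) ^ 2 / (1 - x ^ 2)) (Icc (-x₀) x₀) :=
    continuousOn_const.div (by fun_prop) fun x hx => (one_sub_sq_pos h1 hx).ne'
  fun_prop

theorem LegendreEq.memX₀ (h0 : 0 < x₀) (h1 : x₀ < 1) {u g : ℝ → ℂ} (H : LegendreEq k x₀ u g)
    (hoff : ∀ x, x ∉ Icc (-x₀) x₀ → u x = 0) (hl : u (-x₀) = 0) (hr : u x₀ = 0)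
    (hdl : derivWithin u (Icc (-x₀) x₀) (-x₀) = 0) (hdr : derivWithin u (Icc (-x₀) x₀) x₀ = 0) :
    MemX₀ k x₀ u := by
  have hlt : -x₀ ≤ x₀ := by linarith
  refine ⟨hoff, (H.hasACDeriv h0 h1).ac, ?_, hl, hr, ?_, ?_⟩
  · rw [integrableOn_Icc_iff_integrableOn_Ioo, integrableOn_congr_fun (energyDensity_eqOn _)
      measurableSet_Ioo]
    exact ((H.continuousOn_density h0 h1).integrableOn_compact isCompact_Icc).mono_set
      Ioo_subset_Icc_self
  · rw [← hdl]
    exact (H.differentiableOn _ (left_mem_Icc.2 hlt)).hasDerivWithinAt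
  · rw [← hdr]
    exact (H.differentiableOn _ (right_mem_Icc.2 hlt)).hasDerivWithinAt

/-- Converse of `LegendreEq.perp_of_memX₀`: under orthogonality both coefficients in `solve` and
`solveFlux` vanish at `x₀` as well as at `-x₀`. -/
theorem memX₀_stream (hk : k ≠ 0) (h0 : 0 < x₀) (h1 : x₀ < 1) {f : ℝ → ℂ}
    (hf : MemLp f 2 (volume.restrict (Icc (-x₀) x₀))) (hp : Perp k x₀ f) :
    MemX₀ k x₀ (stream k x₀ f) ∧ LegendreEq k x₀ (stream k x₀ f) f := by
  have hlt : -x₀ ≤ x₀ := by linarith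
  have hl := left_mem_Icc.2 hlt
  have hr := right_mem_Icc.2 hlt
  obtain ⟨H, hflux⟩ := solve_spec hk h0 h1 0 0 hf
  have hind : ∀ x ∈ Icc (-x₀) x₀, stream k x₀ f x = solve k x₀ 0 0 f x :=
    fun x hx => indicator_of_mem hx _
  have H' := H.congr_left h0 hind
  have hd : ∀ x ∈ Icc (-x₀) x₀, solveFlux k x₀ 0 0 f x = 0 →
      derivWithin (stream k x₀ f) (Icc (-x₀) x₀) x = 0 := fun x hx h => by
    have e := hflux x hx
    rw [h, ← derivWithin_congr hind (hind x hx)] at e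
    exact (mul_eq_zero.1 e).resolve_left
      (Complex.ofReal_ne_zero.2 (one_sub_sq_pos h1 hx).ne')
  refine ⟨H'.memX₀ h0 h1 (fun x hx => indicator_of_notMem hx _) ?_ ?_ (hd _ hl ?_) (hd _ hr ?_), H'⟩
  · rw [hind _ hl, solve]; simp
  · rw [hind _ hr, solve, hp.1, hp.2]; simp
  · rw [solveFlux]; simp
  · rw [solveFlux, hp.1, hp.2]; simp

theorem LegendreEq.integral_star_mul_self (h0 : 0 < x₀) (h1 : x₀ < 1) {u f : ℝ → ℂ}
    (H : LegendreEq k x₀ u f) (hu : MemX₀ k x₀ u) :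
    ∫ x in (-x₀)..x₀, (starRingEnd ℂ) (u x) * f x = -(energyNormSq k x₀ u : ℂ) := by
  have hlt : -x₀ ≤ x₀ := by linarith
  rw [H.integral_star_mul h0 h1 H hu.left hu.right, energyNormSq, integral_Icc_eq_integral_Ioo,
    setIntegral_congr_fun measurableSet_Ioo (energyDensity_eqOn u), ← integral_Icc_eq_integral_Ioo,
    integral_Icc_eq_integral_Ioc, ← intervalIntegral.integral_of_le hlt,
    ← intervalIntegral.integral_ofReal]
  congr 1
  refine intervalIntegral.integral_congr fun x _ => ?_
  rw [← Complex.normSq_eq_conj_mul_self, ← Complex.normSq_eq_conj_mul_self,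
    Complex.normSq_eq_norm_sq, Complex.normSq_eq_norm_sq]
  push_cast
  ring

theorem energyNormSq_nonneg (h1 : x₀ < 1) (u : ℝ → ℂ) : 0 ≤ energyNormSq k x₀ u := by
  refine setIntegral_nonneg measurableSet_Icc fun x hx => ?_
  have := one_sub_sq_pos h1 hx
  unfold energyDensity
  positivity

theorem inner_solutionOperator (hk : k ≠ 0) (h0 : 0 < x₀) (h1 : x₀ < 1) (f g : LTwo x₀) :
    ⟪solutionOperator k h0 h1 f, g⟫_ℂ =
      ∫ x in (-x₀)..x₀, (starRingEnd ℂ) (stream k x₀ f x) * g x := by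
  rw [inner_eq_intervalIntegral h0]
  refine intervalIntegral_congr_restrict ?_ ⟨by linarith, le_rfl⟩
  filter_upwards [solutionOperator_ae hk h0 h1 f, ae_restrict_mem measurableSet_Icc] with x hx hm
  rw [hx, stream, indicator_of_mem hm]

theorem norm_sq_eq_integral (f : LTwo x₀) : ‖f‖ ^ 2 = ∫ x in Icc (-x₀) x₀, ‖f x‖ ^ 2 := by
  have h : ((‖f‖ ^ 2 : ℝ) : ℂ) = ((∫ x in Icc (-x₀) x₀, ‖f x‖ ^ 2 : ℝ) : ℂ) := by
    have h2 := inner_self_eq_norm_sq_to_K (𝕜 := ℂ) f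
    rw [L2.inner_def] at h2
    rw [← integral_complex_ofReal]
    push_cast
    refine Eq.trans h2.symm ?_
    refine integral_congr_ae (Filter.Eventually.of_forall fun x => ?_)
    exact inner_self_eq_norm_sq_to_K (𝕜 := ℂ) (f x)
  exact_mod_cast h

/-- Orthogonality makes both stream functions vanish at the two ends, so Green's formula turns each
side into the same Hermitian energy form. -/
theorem inner_solutionOperator_comm (hk : k ≠ 0) (h0 : 0 < x₀) (h1 : x₀ < 1) {f g : LTwo x₀}
    (hf : Perp k x₀ f) (hg : Perp k x₀ g) :
    ⟪solutionOperator k h0 h1 f, g⟫_ℂ = ⟪f, solutionOperator k h0 h1 g⟫_ℂ := by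
  obtain ⟨mf, Hf⟩ := memX₀_stream hk h0 h1 (Lp.memLp f) hf
  obtain ⟨mg, Hg⟩ := memX₀_stream hk h0 h1 (Lp.memLp g) hg
  have hlt : -x₀ ≤ x₀ := by linarith
  rw [← inner_conj_symm f, inner_solutionOperator hk, inner_solutionOperator hk,
    Hf.integral_star_mul h0 h1 Hg mf.left mf.right, Hg.integral_star_mul h0 h1 Hf mg.left mg.right,
    map_neg, intervalIntegral.integral_of_le hlt, intervalIntegral.integral_of_le hlt,
    ← integral_conj]
  congr 1
  refine integral_congr_ae (Filter.Eventually.of_forall fun x => ?_)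
  simp only [map_add, map_mul, Complex.conj_conj, Complex.conj_ofReal]
  ring

theorem isSolution_zero_iff {μ : ℂ} {F Ψ Φ : ℝ → ℂ} : IsSolution k 0 x₀ μ F Ψ Φ ↔
    MemX₀ k x₀ Ψ ∧ LegendreEq k x₀ Ψ Φ ∧ LegendreEq k x₀ Φ (fun x => μ * Φ x + F x) := by
  constructor
  · rintro ⟨h, h', h''⟩
    exact ⟨h, h', h''.congr fun x _ => by simp⟩
  · rintro ⟨h, h', h''⟩
    exact ⟨h, h', h''.congr fun x _ => by simp⟩

/-- The problem in `X₀` is equivalent to an equation for a compact symmetric operator. -/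
theorem exists_symmetric_operator (hk : k ≠ 0) (h0 : 0 < x₀) (h1 : x₀ < 1) :
    ∃ T R : LTwo x₀ →L[ℂ] LTwo x₀, IsCompactOperator T ∧ (∀ f g, ⟪T f, g⟫_ℂ = ⟪f, T g⟫_ℂ) ∧
      (∀ f, ∃ r : ℝ, r ≤ 0 ∧ ⟪f, T f⟫_ℂ = r) ∧ (∀ f : LTwo x₀, Perp k x₀ f → R f = T f) ∧
      (∀ (μ : ℂ) (F Ψ Φ : ℝ → ℂ) (f φ : LTwo x₀), f =ᵐ[volume.restrict (Icc (-x₀) x₀)] F →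
        φ =ᵐ[volume.restrict (Icc (-x₀) x₀)] Φ → IsSolution k 0 x₀ μ F Ψ Φ →
          φ = μ • T φ + R f) ∧
      ∀ (μ : ℂ) (f φ : LTwo x₀), φ = μ • T φ + R f → ∃ Ψ Φ : ℝ → ℂ,
        Φ =ᵐ[volume.restrict (Icc (-x₀) x₀)] φ ∧ IsSolution k 0 x₀ μ f Ψ Φ := by
  obtain ⟨P, hP1, hP2, hP3, hP4, hP5⟩ := exists_projection hk h0 h1
  have hadd : ∀ (μ : ℂ) (φ f : LTwo x₀) {Φ F : ℝ → ℂ},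
      f =ᵐ[volume.restrict (Icc (-x₀) x₀)] F → φ =ᵐ[volume.restrict (Icc (-x₀) x₀)] Φ →
        ((μ • φ + f : LTwo x₀) : ℝ → ℂ) =ᵐ[volume.restrict (Icc (-x₀) x₀)]
          fun x => μ * Φ x + F x := fun μ φ f Φ F hF hΦ => by
    filter_upwards [Lp.coeFn_add (μ • φ) f, Lp.coeFn_smul μ φ, hF, hΦ] with x e1 e2 e3 e4
    rw [e1, Pi.add_apply, e2, Pi.smul_apply, e3, e4, smul_eq_mul]
  have hsplit : ∀ (a b : ℂ) (g : ℝ → ℂ) (x : ℝ),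
      solve k x₀ a b g x = solve k x₀ 0 0 g x + (a * oddSol k x - b * evenSol k x) :=
    fun a b g x => by simp only [solve]; ring
  obtain ⟨G, hGc, hGae, hGs, hGn⟩ : ∃ G : LTwo x₀ →L[ℂ] LTwo x₀, IsCompactOperator G ∧
      (∀ f : LTwo x₀, G f =ᵐ[volume.restrict (Icc (-x₀) x₀)] solve k x₀ 0 0 f) ∧
      (∀ f g : LTwo x₀, Perp k x₀ f → Perp k x₀ g → ⟪G f, g⟫_ℂ = ⟪f, G g⟫_ℂ) ∧
      ∀ f : LTwo x₀, Perp k x₀ f → ⟪G f, f⟫_ℂ = -(energyNormSq k x₀ (stream k x₀ f) : ℂ) := by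
    refine ⟨solutionOperator k h0 h1, isCompactOperator_solutionOperator h0 h1,
      solutionOperator_ae hk h0 h1, fun f g hf hg => inner_solutionOperator_comm hk h0 h1 hf hg,
      fun f hf => ?_⟩
    obtain ⟨m, H⟩ := memX₀_stream hk h0 h1 (Lp.memLp f) hf
    rw [inner_solutionOperator hk, H.integral_star_mul_self h0 h1 m]
  -- `T = P G P` is symmetric, whereas `R = P G` has no inner projection because a source need not
  -- be orthogonal to `N`.
  refine ⟨P ∘L G ∘L P, P ∘L G,
    (hGc.comp_clm P).clm_comp P, fun f g => ?_,
    fun f => ?_, fun f hf => ?_, fun μ F Ψ Φ f φ hF hΦ H => ?_, fun μ f φ h => ?_⟩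
  · change ⟪P (G (P f)), g⟫_ℂ = ⟪f, P (G (P g))⟫_ℂ
    rw [hP3 _ g, ← hP3 f, hGs _ _ (hP1 f) (hP1 g)]
  · refine ⟨-energyNormSq k x₀ (stream k x₀ (P f)), neg_nonpos.2 (energyNormSq_nonneg h1 _), ?_⟩
    change ⟪f, P (G (P f))⟫_ℂ = _
    rw [← hP3 f, ← hGs _ _ (hP1 f) (hP1 f), hGn _ (hP1 f)]
    push_cast
    rfl
  · change P (G f) = P (G (P f))
    rw [hP2 f hf]
  · obtain ⟨hX, hΨ, hV⟩ := isSolution_zero_iff.1 H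
    have hperp : P φ = φ := hP2 φ ((hΨ.perp_of_memX₀ hk h0 h1 hX).1.congr_ae h0 hΦ.symm)
    have hγ := hadd μ φ f hF hΦ
    obtain ⟨a, b, -, -, e⟩ := (hV.congr_ae hγ).eq_solve hk h0 h1
    -- `Φ` differs from `G (μ Φ + F)` by a homogeneous solution, which `P` annihilates.
    have hz : P (φ - G (μ • φ + f)) = 0 := by
      refine hP4 _ a (-b) ?_
      filter_upwards [Lp.coeFn_sub φ (G (μ • φ + f)), hΦ,
        hGae (μ • φ + f), ae_restrict_mem measurableSet_Icc]
        with x e1 e2 e3 hx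
      rw [e1, Pi.sub_apply, e2, e3, e x hx, hsplit a b]
      ring
    rw [map_sub, hperp, sub_eq_zero] at hz
    change φ = μ • P (G (P φ)) + P (G f)
    rw [hperp]
    simpa only [map_add, map_smul] using hz
  · change φ = μ • P (G (P φ)) + P (G f) at h
    have h2 : φ = P (μ • G (P φ) + G f) := by
      rwa [map_add, map_smul]
    have hperp : Perp k x₀ φ := by rw [h2]; exact hP1 _
    have h3 : φ = P (G (μ • φ + f)) := by
      rw [hP2 φ hperp] at h2
      rwa [map_add, map_smul]
    -- `P` alters `G (μ φ + f)` by a homogeneous solution; its coefficients are the parameters of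
    -- the vorticity to be constructed.
    obtain ⟨a, b, hab⟩ := hP5 (G (μ • φ + f))
    have hΦ : solve k x₀ a b (μ • φ + f : LTwo x₀) =ᵐ[volume.restrict (Icc (-x₀) x₀)] φ := by
      rw [← h3] at hab
      filter_upwards [hab, hGae (μ • φ + f)] with x e1 e2
      rw [e1, e2, hsplit a b]
    have H := (solve_spec hk h0 h1 a b (Lp.memLp (μ • φ + f))).1
    obtain ⟨hX, hS⟩ := memX₀_stream hk h0 h1 ((memLp_congr_ae hΦ).2 (Lp.memLp φ))
      (hperp.congr_ae h0 hΦ.symm)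
    refine ⟨_, _, hΦ, isSolution_zero_iff.2 ⟨hX, hS, H.congr_ae ?_⟩⟩
    exact (hadd μ φ f (Filter.EventuallyEq.refl _ _) hΦ.symm).symm

/-- The energy is `-⟪G φ, φ⟫`, to which Cauchy–Schwarz applies. -/
theorem IsSolution.energyNormSq_le (hk : k ≠ 0) (h0 : 0 < x₀) (h1 : x₀ < 1) {μ : ℂ}
    {F Ψ Φ : ℝ → ℂ} (H : IsSolution k 0 x₀ μ F Ψ Φ) {φ : LTwo x₀}
    (hφ : φ =ᵐ[volume.restrict (Icc (-x₀) x₀)] Φ) :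
    energyNormSq k x₀ Ψ ≤ ‖solutionOperator k h0 h1‖ * ‖φ‖ ^ 2 := by
  have e := H.stream_eq.congr_ae hφ
  have h := inner_solutionOperator hk h0 h1 φ φ
  rw [← e.eq_stream hk h0 h1 H.memX₀, e.integral_star_mul_self h0 h1 H.memX₀] at h
  have h2 := norm_inner_le_norm (𝕜 := ℂ) (solutionOperator k h0 h1 φ) φ
  rw [h, norm_neg, Complex.norm_real, Real.norm_of_nonneg (energyNormSq_nonneg h1 _)] at h2
  refine h2.trans ?_
  rw [pow_two, ← mul_assoc]
  exact mul_le_mul_of_nonneg_right ((solutionOperator k h0 h1).le_opNorm φ) (norm_nonneg _)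

end Bridge

/-! ### Reflection symmetry and the dimension of eigenspaces -/

section Parity

open scoped InnerProductSpace

theorem neg_mem_Icc_symm {x : ℝ} (hx : x ∈ Icc (-x₀) x₀) : -x ∈ Icc (-x₀) x₀ :=
  ⟨by linarith [hx.2], by linarith [hx.1]⟩

theorem derivWithin_reflect (u : ℝ → ℂ) (x : ℝ) :
    derivWithin (fun y => u (-y)) (Icc (-x₀) x₀) x = -derivWithin u (Icc (-x₀) x₀) (-x) := by
  rw [derivWithin_comp_neg]
  simp

theorem LegendreEq.reflect (h0 : 0 < x₀) (h1 : x₀ < 1) {u g : ℝ → ℂ} (H : LegendreEq k x₀ u g) :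
    LegendreEq k x₀ (fun x => u (-x)) (fun x => g (-x)) := by
  have hlt : -x₀ ≤ x₀ := by linarith
  refine ⟨H.differentiableOn.comp (by fun_prop) fun x hx => neg_mem_Icc_symm hx, ?_,
    fun x hx => ?_⟩
  · have hmp := (Measure.measurePreserving_neg (volume : Measure ℝ)).restrict_preimage
      (measurableSet_Icc (a := -x₀) (b := x₀))
    have he : Neg.neg ⁻¹' Icc (-x₀) x₀ = Icc (-x₀) x₀ := by simp
    rw [he] at hmp
    exact H.memLp.comp_measurePreserving hmp
  · have hi := H.intervalIntegrable h1 (right_mem_Icc.2 hlt)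
    have hx' : -x ∈ uIcc (-x₀) x₀ := by rw [uIcc_of_le hlt]; exact neg_mem_Icc_symm hx
    have hadj := intervalIntegral.integral_add_adjacent_intervals
      (hi.mono_set (uIcc_subset_uIcc_left hx')) (hi.mono_set (uIcc_subset_uIcc_right hx'))
    have hc := intervalIntegral.integral_comp_neg (a := -x₀) (b := x)
      (fun t => g t + (((k : ℝ) ^ 2 / (1 - t ^ 2) : ℝ) : ℂ) * u t)
    simp only [neg_sq, neg_neg] at hc
    have f1 := H.flux _ (neg_mem_Icc_symm hx)
    have f2 := H.flux _ (right_mem_Icc.2 hlt)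
    rw [neg_sq] at f1
    rw [derivWithin_reflect, derivWithin_reflect, neg_neg, hc]
    -- Reflection moves the base point of the flux identity to `x₀`; the identity over the whole
    -- interval moves it back to `-x₀`.
    linear_combination -f1 + f2 - hadj

theorem MemX₀.reflect (h0 : 0 < x₀) (h1 : x₀ < 1) {u g : ℝ → ℂ} (H : LegendreEq k x₀ u g)
    (hu : MemX₀ k x₀ u) : MemX₀ k x₀ (fun x => u (-x)) := by
  have hlt : -x₀ < x₀ := by linarith
  have hU := uniqueDiffOn_Icc hlt
  refine (H.reflect h0 h1).memX₀ h0 h1 (fun x hx => hu.eq_zero_off _ fun h => hx ?_) ?_ ?_ ?_ ?_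
  · simpa using neg_mem_Icc_symm h
  · rw [neg_neg, hu.right]
  · exact hu.left
  · rw [derivWithin_reflect, neg_neg, hu.deriv_right.derivWithin (hU _ (right_mem_Icc.2 hlt.le)),
      neg_zero]
  · rw [derivWithin_reflect, hu.deriv_left.derivWithin (hU _ (left_mem_Icc.2 hlt.le)), neg_zero]

theorem IsSolution.reflect (h0 : 0 < x₀) (h1 : x₀ < 1) {μ : ℂ} {F Ψ Φ : ℝ → ℂ}
    (H : IsSolution k 0 x₀ μ F Ψ Φ) :
    IsSolution k 0 x₀ μ (fun x => F (-x)) (fun x => Ψ (-x)) (fun x => Φ (-x)) := by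
  obtain ⟨hX, hS, hV⟩ := isSolution_zero_iff.1 H
  exact isSolution_zero_iff.2 ⟨hX.reflect h0 h1 hS, hS.reflect h0 h1, hV.reflect h0 h1⟩

theorem IsSolution.congr_source {μ : ℂ} {F F' Ψ Φ : ℝ → ℂ} (H : IsSolution k 0 x₀ μ F Ψ Φ)
    (e : F' =ᵐ[volume.restrict (Icc (-x₀) x₀)] F) : IsSolution k 0 x₀ μ F' Ψ Φ := by
  obtain ⟨hX, hS, hV⟩ := isSolution_zero_iff.1 H
  refine isSolution_zero_iff.2 ⟨hX, hS, hV.congr_ae ?_⟩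
  filter_upwards [e] with x hx
  rw [hx]

/-- An eigenpair whose vorticity has vanishing Cauchy data at the midpoint is trivial. -/
theorem IsSolution.eq_zero_of_cauchy_data (hk : k ≠ 0) (h0 : 0 < x₀) (h1 : x₀ < 1) {μ : ℂ}
    {Ψ Φ : ℝ → ℂ} (H : IsSolution k 0 x₀ μ 0 Ψ Φ) (hz : Φ 0 = 0)
    (hd : derivWithin Φ (Icc (-x₀) x₀) 0 = 0) : Ψ = 0 := by
  have hlt : -x₀ < x₀ := by linarith
  obtain ⟨hX, hS, hV⟩ := isSolution_zero_iff.1 H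
  have hc := hV.differentiableOn.continuousOn
  have hw := weight_continuousOn (k := k) h1
  have hflux := hV.hasACDeriv_flux h0 h1
  -- The vorticity equation as a linear system for `Φ` and its flux. `K` below is the sum of the
  -- Lipschitz bounds of the two components.
  let v : ℝ → ℂ × ℂ → ℂ × ℂ := fun t y =>
    (((1 / (1 - t ^ 2) : ℝ) : ℂ) * y.2, (μ + (((k : ℝ) ^ 2 / (1 - t ^ 2) : ℝ) : ℂ)) * y.1)
  let M : ℝ := 1 / (1 - x₀ ^ 2)
  have hM : 0 < 1 - x₀ ^ 2 := by nlinarith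
  have hM0 : 0 ≤ M := by positivity
  have hbound : ∀ t ∈ Ioo (-x₀) x₀, 0 ≤ 1 / (1 - t ^ 2) ∧ 1 / (1 - t ^ 2) ≤ M := fun t ht => by
    have h2 : t ^ 2 ≤ x₀ ^ 2 := sq_le_sq' ht.1.le ht.2.le
    exact ⟨by have : 0 < 1 - t ^ 2 := by linarith
              positivity, one_div_le_one_div_of_le hM (by linarith)⟩
  let K : NNReal := ⟨M + (‖μ‖ + (k : ℝ) ^ 2 * M), by positivity⟩
  have hL : ∀ t ∈ Ioo (-x₀) x₀, LipschitzOnWith K (v t) univ := by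
    intro t ht
    obtain ⟨b0, b1⟩ := hbound t ht
    refine LipschitzOnWith.of_dist_le_mul fun y _ z _ => ?_
    have n1 : dist y.1 z.1 ≤ dist y z := le_max_left _ _
    have n2 : dist y.2 z.2 ≤ dist y z := le_max_right _ _
    have hK : (K : ℝ) = M + (‖μ‖ + (k : ℝ) ^ 2 * M) := rfl
    rw [Prod.dist_eq, hK]
    refine max_le ?_ ?_
    · simp only [v]
      rw [dist_eq_norm, ← mul_sub, norm_mul, Complex.norm_real, Real.norm_of_nonneg b0,
        ← dist_eq_norm]
      refine mul_le_mul (b1.trans (le_add_of_nonneg_right (by positivity))) n2 dist_nonneg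
        (by positivity)
    · simp only [v]
      rw [dist_eq_norm, ← mul_sub, norm_mul, ← dist_eq_norm]
      refine mul_le_mul ?_ n1 dist_nonneg (by positivity)
      refine (norm_add_le _ _).trans ?_
      rw [Complex.norm_real, div_eq_mul_one_div, norm_mul, Real.norm_of_nonneg b0,
        Real.norm_of_nonneg (sq_nonneg _)]
      have := mul_le_mul_of_nonneg_left b1 (sq_nonneg (k : ℝ))
      linarith
  have hsol : ∀ t ∈ Ioo (-x₀) x₀, HasDerivAt
      (fun t => (Φ t, ((1 - t ^ 2 : ℝ) : ℂ) * derivWithin Φ (Icc (-x₀) x₀) t))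
      (v t (Φ t, ((1 - t ^ 2 : ℝ) : ℂ) * derivWithin Φ (Icc (-x₀) x₀) t)) t ∧
      (Φ t, ((1 - t ^ 2 : ℝ) : ℂ) * derivWithin Φ (Icc (-x₀) x₀) t) ∈ (univ : Set (ℂ × ℂ)) := by
    intro t ht
    have ht' := Ioo_subset_Icc_self ht
    have hn : Icc (-x₀) x₀ ∈ nhds t := Icc_mem_nhds ht.1 ht.2
    have hp : ((1 - t ^ 2 : ℝ) : ℂ) ≠ 0 := Complex.ofReal_ne_zero.2 (one_sub_sq_pos h1 ht').ne'
    refine ⟨HasDerivAt.prodMk ?_ ?_, mem_univ _⟩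
    · refine ((hV.differentiableOn t ht').hasDerivWithinAt.hasDerivAt hn).congr_deriv ?_
      simp only
      rw [Complex.ofReal_div, Complex.ofReal_one]
      field_simp
    · refine ((hflux.hasDerivWithinAt hlt ?_ ht').hasDerivAt hn).congr_deriv ?_
      · exact ((hc.const_smul μ).add continuousOn_const).add (hw.mul hc)
      · simp only [Pi.zero_apply]
        ring
  have hzero : ∀ t ∈ Ioo (-x₀) x₀, HasDerivAt (fun _ : ℝ => (0 : ℂ × ℂ)) (v t 0) t ∧
      (0 : ℂ × ℂ) ∈ (univ : Set (ℂ × ℂ)) := fun t _ =>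
    ⟨(hasDerivAt_const t (0 : ℂ × ℂ)).congr_deriv (by simp [v]; rfl), mem_univ _⟩
  have heq := ODE_solution_unique_of_mem_Ioo (t₀ := 0) hL ⟨by linarith, h0⟩ hsol hzero
    (by simp only [hz, hd, mul_zero]; rfl)
  have hae : Φ =ᵐ[volume.restrict (Icc (-x₀) x₀)] (0 : ℝ → ℂ) := by
    rw [← restrict_Ioo_eq_restrict_Icc]
    filter_upwards [ae_restrict_mem measurableSet_Ioo] with t ht
    exact congrArg Prod.fst (heq ht)
  rw [hS.eq_stream hk h0 h1 hX, stream_congr_ae hae]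
  ext x
  by_cases hx : x ∈ Icc (-x₀) x₀
  · rw [stream, indicator_of_mem hx, solve]; simp
  · rw [stream, indicator_of_notMem hx]; rfl

/-- The part of parity `s` of an eigenpair. -/
theorem IsSolution.parity_part (h0 : 0 < x₀) (h1 : x₀ < 1) (s : ℂ) {μ : ℂ} {Ψ Φ : ℝ → ℂ}
    (H : IsSolution k 0 x₀ μ 0 Ψ Φ) : IsSolution k 0 x₀ μ 0
      ((1 / 2 : ℂ) • (Ψ + s • fun x => Ψ (-x))) ((1 / 2 : ℂ) • (Φ + s • fun x => Φ (-x))) := by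
  have h := (H.add h0 h1 ((H.reflect h0 h1).smul s)).smul (1 / 2)
  have e : (1 / 2 : ℂ) • ((0 : ℝ → ℂ) + s • fun x => (0 : ℝ → ℂ) (-x)) = 0 := by
    ext x; simp
  rwa [e] at h

/-- A vorticity of fixed parity has one free Cauchy datum at `0`: the value if even, the derivative
if odd. The combination of two that cancels this datum has zero Cauchy data, hence is trivial. -/
theorem IsSolution.exists_smul_eq (hk : k ≠ 0) (h0 : 0 < x₀) (h1 : x₀ < 1) {s : ℂ}
    (hs : s = 1 ∨ s = -1) {μ : ℂ} {Ψ₁ Φ₁ Ψ₂ Φ₂ : ℝ → ℂ}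
    (H₁ : IsSolution k 0 x₀ μ 0 Ψ₁ Φ₁) (H₂ : IsSolution k 0 x₀ μ 0 Ψ₂ Φ₂) (hne : Ψ₁ ≠ 0)
    (p₁ : ∀ x, Ψ₁ (-x) = s * Ψ₁ x) (p₂ : ∀ x, Ψ₂ (-x) = s * Ψ₂ x) : ∃ c : ℂ, c • Ψ₁ = Ψ₂ := by
  have hss : s * s = 1 := by rcases hs with rfl | rfl <;> norm_num
  have hpart : ∀ Ψ : ℝ → ℂ, (∀ x, Ψ (-x) = s * Ψ x) →
      (1 / 2 : ℂ) • (Ψ + s • fun x => Ψ (-x)) = Ψ := fun Ψ p => by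
    ext x
    simp only [Pi.smul_apply, Pi.add_apply, smul_eq_mul, p x]
    linear_combination 1 / 2 * Ψ x * hss
  have hpar : ∀ (Φ : ℝ → ℂ) (x : ℝ), ((1 / 2 : ℂ) • (Φ + s • fun x => Φ (-x))) (-x) =
      s * ((1 / 2 : ℂ) • (Φ + s • fun x => Φ (-x))) x := fun Φ x => by
    simp only [Pi.smul_apply, Pi.add_apply, smul_eq_mul, neg_neg]
    linear_combination -(1 / 2) * Φ (-x) * hss
  -- Only the stream functions are assumed to have parity `s`. Taking parity parts leaves them
  -- unchanged and supplies vorticities of parity `s`.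
  have G₁ := H₁.parity_part h0 h1 s
  have G₂ := H₂.parity_part h0 h1 s
  rw [hpart _ p₁] at G₁
  rw [hpart _ p₂] at G₂
  generalize hφ₁ : (1 / 2 : ℂ) • (Φ₁ + s • fun x => Φ₁ (-x)) = φ₁ at G₁
  generalize hφ₂ : (1 / 2 : ℂ) • (Φ₂ + s • fun x => Φ₂ (-x)) = φ₂ at G₂
  have q₁ := hpar Φ₁
  have q₂ := hpar Φ₂
  rw [hφ₁] at q₁
  rw [hφ₂] at q₂
  have hm : (0 : ℝ) ∈ Icc (-x₀) x₀ := ⟨by linarith, h0.le⟩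
  have hder : ∀ φ : ℝ → ℂ, DifferentiableOn ℝ φ (Icc (-x₀) x₀) → (∀ x, φ (-x) = s * φ x) →
      s * derivWithin φ (Icc (-x₀) x₀) 0 = -derivWithin φ (Icc (-x₀) x₀) 0 := fun φ hd q => by
    have e := derivWithin_reflect (x₀ := x₀) φ 0
    rw [neg_zero] at e
    rw [← e, funext q, derivWithin_const_mul s (hd 0 hm)]
  have d₁ := G₁.vorticity_eq.differentiableOn
  have d₂ := G₂.vorticity_eq.differentiableOn
  -- `ℓ₁` and `ℓ₂` are the free Cauchy data of the two vorticities.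
  have key : ∃ ℓ₁ ℓ₂ : ℂ, (ℓ₁ = 0 → φ₁ 0 = 0 ∧ derivWithin φ₁ (Icc (-x₀) x₀) 0 = 0) ∧
      ℓ₂ * φ₁ 0 + -ℓ₁ * φ₂ 0 = 0 ∧
      ℓ₂ * derivWithin φ₁ (Icc (-x₀) x₀) 0 + -ℓ₁ * derivWithin φ₂ (Icc (-x₀) x₀) 0 = 0 := by
    have e₁ := hder _ d₁ q₁
    have e₂ := hder _ d₂ q₂
    have r₁ := q₁ 0
    have r₂ := q₂ 0
    rw [neg_zero] at r₁ r₂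
    rcases hs with rfl | rfl
    · have z₁ : derivWithin φ₁ (Icc (-x₀) x₀) 0 = 0 := by linear_combination 1 / 2 * e₁
      have z₂ : derivWithin φ₂ (Icc (-x₀) x₀) 0 = 0 := by linear_combination 1 / 2 * e₂
      exact ⟨φ₁ 0, φ₂ 0, fun h => ⟨h, z₁⟩, by ring, by rw [z₁, z₂]; ring⟩
    · have z₁ : φ₁ 0 = 0 := by linear_combination 1 / 2 * r₁
      have z₂ : φ₂ 0 = 0 := by linear_combination 1 / 2 * r₂
      exact ⟨derivWithin φ₁ (Icc (-x₀) x₀) 0, derivWithin φ₂ (Icc (-x₀) x₀) 0, fun h => ⟨z₁, h⟩,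
        by rw [z₁, z₂]; ring, by ring⟩
  obtain ⟨ℓ₁, ℓ₂, n₁, n₂, n₃⟩ := key
  have hℓ : ℓ₁ ≠ 0 := fun h => hne (G₁.eq_zero_of_cauchy_data hk h0 h1 (n₁ h).1 (n₁ h).2)
  have G := (G₁.smul ℓ₂).add h0 h1 (G₂.smul (-ℓ₁))
  rw [smul_zero, smul_zero, add_zero] at G
  have hz := G.eq_zero_of_cauchy_data hk h0 h1 n₂ (by
    rw [derivWithin_add ((d₁ 0 hm).const_smul _) ((d₂ 0 hm).const_smul _),
      derivWithin_const_smul _ (d₁ 0 hm), derivWithin_const_smul _ (d₂ 0 hm)]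
    exact n₃)
  refine ⟨ℓ₂ / ℓ₁, ?_⟩
  rw [neg_smul, add_neg_eq_zero] at hz
  rw [div_eq_inv_mul, mul_smul, hz, smul_smul, inv_mul_cancel₀ hℓ, one_smul]

/-- An eigenspace has dimension one, or is spanned by an even and an odd eigenfunction. -/
theorem finrank_eigenspace (hk : k ≠ 0) (h0 : 0 < x₀) (h1 : x₀ < 1) {μ : ℂ}
    (hμ : IsEigenvalue k 0 x₀ μ) :
    Module.finrank ℂ (eigenspace k 0 x₀ h0 h1 μ) = 1 ∨
      (Module.finrank ℂ (eigenspace k 0 x₀ h0 h1 μ) = 2 ∧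
        ∃ Ψe ∈ eigenspace k 0 x₀ h0 h1 μ, ∃ Ψo ∈ eigenspace k 0 x₀ h0 h1 μ,
          (∀ x, Ψe (-x) = Ψe x) ∧ (∀ x, Ψo (-x) = -Ψo x) ∧ LinearIndependent ℂ ![Ψe, Ψo]) := by
  set S := eigenspace k 0 x₀ h0 h1 μ
  have hpart : ∀ s : ℂ, s * s = 1 → ∀ Ψ ∈ S, (1 / 2 : ℂ) • (Ψ + s • fun x => Ψ (-x)) ∈ S ∧
      ∀ x, ((1 / 2 : ℂ) • (Ψ + s • fun x => Ψ (-x))) (-x) =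
        s * ((1 / 2 : ℂ) • (Ψ + s • fun x => Ψ (-x))) x := by
    rintro s hss Ψ ⟨Φ, H⟩
    refine ⟨⟨_, H.parity_part h0 h1 s⟩, fun x => ?_⟩
    simp only [Pi.smul_apply, Pi.add_apply, smul_eq_mul, neg_neg]
    linear_combination -(1 / 2) * Ψ (-x) * hss
  have hsum : ∀ Ψ : ℝ → ℂ, (1 / 2 : ℂ) • (Ψ + (1 : ℂ) • fun x => Ψ (-x)) +
      (1 / 2 : ℂ) • (Ψ + (-1 : ℂ) • fun x => Ψ (-x)) = Ψ := fun Ψ => by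
    ext x
    simp only [Pi.smul_apply, Pi.add_apply, smul_eq_mul]
    ring
  have hdep : ∀ s : ℂ, s = 1 ∨ s = -1 → ∀ Ψ₁ ∈ S, ∀ Ψ₂ ∈ S, Ψ₁ ≠ 0 →
      (∀ x, Ψ₁ (-x) = s * Ψ₁ x) → (∀ x, Ψ₂ (-x) = s * Ψ₂ x) → ∃ c : ℂ, c • Ψ₁ = Ψ₂ := by
    rintro s hs Ψ₁ ⟨Φ₁, H₁⟩ Ψ₂ ⟨Φ₂, H₂⟩ hne p₁ p₂
    exact H₁.exists_smul_eq hk h0 h1 hs H₂ hne p₁ p₂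
  -- If one parity is absent, every eigenfunction equals its part of the other parity, and all of
  -- these are proportional.
  have hone : ∀ s t : ℂ, s = 1 ∧ t = -1 ∨ s = -1 ∧ t = 1 → (∀ Ψ ∈ S, (∀ x, Ψ (-x) = t * Ψ x) → Ψ = 0) →
      Module.finrank ℂ S = 1 := by
    intro s t hst hz
    have hs : s = 1 ∨ s = -1 := by tauto
    have hs2 : s * s = 1 := by rcases hs with rfl | rfl <;> norm_num
    have ht2 : t * t = 1 := by rcases hst with ⟨-, rfl⟩ | ⟨-, rfl⟩ <;> norm_num
    have hall : ∀ Ψ ∈ S, ∀ x, Ψ (-x) = s * Ψ x := fun Ψ hΨ => by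
      have e1 := hsum Ψ
      have e2 := hz _ (hpart t ht2 Ψ hΨ).1 (hpart t ht2 Ψ hΨ).2
      have e3 := (hpart s hs2 Ψ hΨ).2
      have e4 : (1 / 2 : ℂ) • (Ψ + s • fun x => Ψ (-x)) = Ψ := by
        rcases hst with ⟨rfl, rfl⟩ | ⟨rfl, rfl⟩
        · rwa [e2, add_zero] at e1
        · rwa [e2, zero_add] at e1
      rwa [e4] at e3
    obtain ⟨Ψ, Φ, hne, H⟩ := hμ
    have hmem : Ψ ∈ S := ⟨Φ, H⟩
    refine finrank_eq_one (⟨Ψ, hmem⟩ : S) (fun h => hne (congrArg Subtype.val h)) fun w => ?_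
    obtain ⟨c, hc⟩ := hdep s hs Ψ hmem w w.2 hne (hall _ hmem) (hall _ w.2)
    exact ⟨c, Subtype.ext hc⟩
  by_cases he : ∀ Ψ ∈ S, (∀ x, Ψ (-x) = 1 * Ψ x) → Ψ = 0
  · exact Or.inl (hone (-1) 1 (Or.inr ⟨rfl, rfl⟩) he)
  by_cases ho : ∀ Ψ ∈ S, (∀ x, Ψ (-x) = -1 * Ψ x) → Ψ = 0
  · exact Or.inl (hone 1 (-1) (Or.inl ⟨rfl, rfl⟩) ho)
  right
  push Not at he ho
  obtain ⟨Ψe, he1, he2, he3⟩ := he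
  obtain ⟨Ψo, ho1, ho2, ho3⟩ := ho
  have hli : LinearIndependent ℂ ![Ψe, Ψo] := by
    rw [LinearIndependent.pair_iff' he3]
    rintro a rfl
    apply ho3
    ext x
    have h1 := ho2 x
    simp only [Pi.smul_apply, smul_eq_mul, he2 x] at h1
    simp only [Pi.smul_apply, smul_eq_mul, Pi.zero_apply]
    linear_combination 1 / 2 * h1
  have hspan : S = Submodule.span ℂ (Set.range ![Ψe, Ψo]) := by
    have hr : Set.range ![Ψe, Ψo] = {Ψe, Ψo} := by simp [Set.pair_comm]
    rw [hr]
    refine le_antisymm (fun Ψ hΨ => ?_) (Submodule.span_le.2 ?_)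
    · obtain ⟨a, ha⟩ := hdep 1 (Or.inl rfl) Ψe he1 _ (hpart 1 (by norm_num) Ψ hΨ).1 he3 he2
        (hpart 1 (by norm_num) Ψ hΨ).2
      obtain ⟨b, hb⟩ := hdep (-1) (Or.inr rfl) Ψo ho1 _ (hpart (-1) (by norm_num) Ψ hΨ).1 ho3 ho2
        (hpart (-1) (by norm_num) Ψ hΨ).2
      exact Submodule.mem_span_pair.2 ⟨a, b, by rw [ha, hb, hsum]⟩
    · rintro _ (rfl | rfl)
      exacts [he1, ho1]
  refine ⟨?_, Ψe, he1, Ψo, ho1, fun x => by simpa using he2 x, fun x => by simpa using ho2 x, hli⟩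
  rw [hspan, finrank_span_eq_card hli, Fintype.card_fin]

end Parity

/-! ### Eigenvalues, resolvent points and generalized eigenfunctions in terms of `T` -/

section Spectrum

open scoped InnerProductSpace

theorem IsSolution.eq_of_ae_eq (hk : k ≠ 0) (h0 : 0 < x₀) (h1 : x₀ < 1) {μ : ℂ}
    {F F' Ψ Ψ' Φ Φ' : ℝ → ℂ} (H : IsSolution k 0 x₀ μ F Ψ Φ) (H' : IsSolution k 0 x₀ μ F' Ψ' Φ')
    (e : Φ =ᵐ[volume.restrict (Icc (-x₀) x₀)] Φ') : Ψ = Ψ' := by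
  rw [H.stream_eq.eq_stream hk h0 h1 H.memX₀, H'.stream_eq.eq_stream hk h0 h1 H'.memX₀,
    stream_congr_ae e]

theorem IsSolution.memLp {μ : ℂ} {F Ψ Φ : ℝ → ℂ} (H : IsSolution k 0 x₀ μ F Ψ Φ) :
    MemLp Φ 2 (volume.restrict (Icc (-x₀) x₀)) :=
  H.stream_eq.memLp

/-- `μ` is an eigenvalue if and only if `1 - μ T` is not injective. -/
theorem isEigenvalue_iff (hk : k ≠ 0) (h0 : 0 < x₀) (h1 : x₀ < 1)
    {T R : LTwo x₀ →L[ℂ] LTwo x₀}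
    (hto : ∀ (μ : ℂ) (F Ψ Φ : ℝ → ℂ) (f φ : LTwo x₀),
      f =ᵐ[volume.restrict (Icc (-x₀) x₀)] F → φ =ᵐ[volume.restrict (Icc (-x₀) x₀)] Φ →
        IsSolution k 0 x₀ μ F Ψ Φ → φ = μ • T φ + R f)
    (hof : ∀ (μ : ℂ) (f φ : LTwo x₀), φ = μ • T φ + R f → ∃ Ψ Φ : ℝ → ℂ,
      Φ =ᵐ[volume.restrict (Icc (-x₀) x₀)] φ ∧ IsSolution k 0 x₀ μ f Ψ Φ) (μ : ℂ) :
    IsEigenvalue k 0 x₀ μ ↔ ∃ φ, φ ≠ 0 ∧ φ = μ • T φ := by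
  have hzero := Lp.coeFn_zero ℂ 2 (volume.restrict (Icc (-x₀) x₀))
  constructor
  · rintro ⟨Ψ, Φ, hne, H⟩
    have hφ := H.memLp.coeFn_toLp
    refine ⟨H.memLp.toLp, fun h => hne ?_, ?_⟩
    · rw [h] at hφ
      exact H.eq_of_ae_eq hk h0 h1 (IsSolution.zero k 0 x₀ μ) (hφ.symm.trans hzero)
    · have := hto μ 0 Ψ Φ 0 _ hzero hφ H
      rwa [map_zero, add_zero] at this
  · rintro ⟨φ, hne, h⟩
    obtain ⟨Ψ, Φ, hφ, H⟩ := hof μ 0 φ (by rwa [map_zero, add_zero])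
    refine ⟨Ψ, Φ, ?_, H.congr_source hzero.symm⟩
    rintro rfl
    refine hne (Lp.ext ?_)
    exact hφ.symm.trans ((H.stream_eq.ae_eq h0 h1 (LegendreEq.zero k x₀) fun _ _ => rfl).trans
      hzero.symm)

/-- The vorticity must be `(1 - μ T)⁻¹ R f`, which yields existence, uniqueness and the bound
together. In the constant, `‖G‖` comes from the energy and `1` from the norm of `Φ` itself. -/
theorem isResolventPoint_of_isUnit (hk : k ≠ 0) (h0 : 0 < x₀) (h1 : x₀ < 1)
    {T R : LTwo x₀ →L[ℂ] LTwo x₀}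
    (hto : ∀ (μ : ℂ) (F Ψ Φ : ℝ → ℂ) (f φ : LTwo x₀),
      f =ᵐ[volume.restrict (Icc (-x₀) x₀)] F → φ =ᵐ[volume.restrict (Icc (-x₀) x₀)] Φ →
        IsSolution k 0 x₀ μ F Ψ Φ → φ = μ • T φ + R f)
    (hof : ∀ (μ : ℂ) (f φ : LTwo x₀), φ = μ • T φ + R f → ∃ Ψ Φ : ℝ → ℂ,
      Φ =ᵐ[volume.restrict (Icc (-x₀) x₀)] φ ∧ IsSolution k 0 x₀ μ f Ψ Φ) {μ : ℂ}
    (hu : IsUnit (1 - μ • T)) : IsResolventPoint k 0 x₀ μ := by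
  obtain ⟨⟨A, B, hAB, hBA⟩, rfl : A = _⟩ := hu
  have hl : ∀ v, B (v - μ • T v) = v := fun v => by
    have := congrArg (fun S : LTwo x₀ →L[ℂ] LTwo x₀ => S v) hBA
    exact this
  have hr : ∀ v, B v - μ • T (B v) = v := fun v => by
    have := congrArg (fun S : LTwo x₀ →L[ℂ] LTwo x₀ => S v) hAB
    exact this
  have hsol : ∀ (F Ψ Φ : ℝ → ℂ) (hF : MemLp F 2 (volume.restrict (Icc (-x₀) x₀)))
      (H : IsSolution k 0 x₀ μ F Ψ Φ), H.memLp.toLp = B (R hF.toLp) := fun F Ψ Φ hF H => by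
    have h := hto μ F Ψ Φ hF.toLp H.memLp.toLp hF.coeFn_toLp H.memLp.coeFn_toLp H
    rw [← sub_eq_iff_eq_add'] at h
    rw [← h, hl]
  refine ⟨fun F hF => ?_, (‖solutionOperator k h0 h1‖ + 1) * ‖B ∘L R‖ ^ 2,
    fun F Ψ Φ hF H => ?_⟩
  · obtain ⟨Ψ, Φ, -, H⟩ := hof μ hF.toLp (B (R hF.toLp))
      (by rw [← sub_eq_iff_eq_add', hr])
    have H' := H.congr_source hF.coeFn_toLp.symm
    refine ⟨Ψ, ⟨Φ, H'⟩, ?_⟩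
    rintro Ψ' ⟨Φ', H''⟩
    have e : H''.memLp.toLp = H'.memLp.toLp := by
      rw [hsol _ _ _ hF H'', hsol _ _ _ hF H']
    exact H''.eq_of_ae_eq hk h0 h1 H' ((MemLp.toLp_eq_toLp_iff _ _).1 e)
  · have e1 := H.energyNormSq_le hk h0 h1 H.memLp.coeFn_toLp
    have e2 : ∫ x in Icc (-x₀) x₀, ‖Φ x‖ ^ 2 = ‖H.memLp.toLp‖ ^ 2 := by
      rw [norm_sq_eq_integral]
      refine integral_congr_ae ?_
      filter_upwards [H.memLp.coeFn_toLp] with x hx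
      rw [hx]
    have e3 : ∫ x in Icc (-x₀) x₀, ‖F x‖ ^ 2 = ‖hF.toLp‖ ^ 2 := by
      rw [norm_sq_eq_integral]
      refine integral_congr_ae ?_
      filter_upwards [hF.coeFn_toLp] with x hx
      rw [hx]
    have e4 : ‖H.memLp.toLp‖ ^ 2 ≤ ‖B ∘L R‖ ^ 2 * ‖hF.toLp‖ ^ 2 := by
      rw [hsol F Ψ Φ hF H, ← mul_pow]
      exact pow_le_pow_left₀ (norm_nonneg _) ((B ∘L R).le_opNorm hF.toLp) 2
    rw [e2, e3]
    calc _ ≤ (‖solutionOperator k h0 h1‖ + 1) * ‖H.memLp.toLp‖ ^ 2 := by linarith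
      _ ≤ (‖solutionOperator k h0 h1‖ + 1) * (‖B ∘L R‖ ^ 2 * ‖hF.toLp‖ ^ 2) := by gcongr
      _ = _ := by ring

theorem IsEigenvalue.not_isResolventPoint {μ : ℂ} (h : IsEigenvalue k 0 x₀ μ) :
    ¬ IsResolventPoint k 0 x₀ μ := by
  rintro ⟨hu, -⟩
  obtain ⟨Ψ, Φ, hne, H⟩ := h
  exact hne ((hu 0 MemLp.zero).unique ⟨Φ, H⟩ ⟨0, IsSolution.zero k 0 x₀ μ⟩)

/-- All generalized eigenfunctions are eigenfunctions. -/
theorem rootSpace_eq_eigenspace (hk : k ≠ 0) (h0 : 0 < x₀) (h1 : x₀ < 1) (μ : ℂ) :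
    rootSpace k 0 x₀ h0 h1 μ = eigenspace k 0 x₀ h0 h1 μ := by
  obtain ⟨T, R, -, hs, -, hRT, hto, -⟩ := exists_symmetric_operator hk h0 h1
  have hzero := Lp.coeFn_zero ℂ 2 (volume.restrict (Icc (-x₀) x₀))
  refine le_antisymm (iSup_le fun n => ?_) fun Ψ hΨ => ?_
  · induction n with
    | zero => exact bot_le
    | succ n ih =>
      rintro Ψ ⟨Ψ', hΨ', Φ', Φ, H', H⟩
      -- By induction `Ψ'` is already an eigenfunction, so only chains of length two need excluding.
      obtain ⟨Φ₁, H₁⟩ := ih hΨ'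
      have e1 : Φ' =ᵐ[volume.restrict (Icc (-x₀) x₀)] Φ₁ :=
        H'.ae_eq h0 h1 H₁.stream_eq fun _ _ => rfl
      have hf := H'.memLp.coeFn_toLp
      have h2 := hto μ 0 Ψ' Φ₁ 0 H'.memLp.toLp hzero (hf.trans e1) H₁
      rw [map_zero, add_zero] at h2
      have h3 := hto μ Φ' Ψ Φ H'.memLp.toLp H.memLp.toLp hf H.memLp.coeFn_toLp H
      -- The source is the vorticity of an element of `X₀`, hence orthogonal to `N`. There `R`
      -- agrees with `T`, and the relation becomes a Jordan chain for `T`.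
      rw [hRT _ ((H'.perp_of_memX₀ hk h0 h1 H₁.memX₀).1.congr_ae h0 hf.symm)] at h3
      have h4 := eq_zero_of_chain hs h2 h3
      rw [h4] at hf
      exact ⟨Φ, H.congr_source (hzero.symm.trans hf)⟩
  · obtain ⟨Φ, H⟩ := hΨ
    refine Submodule.mem_iSup_of_mem 1 ?_
    exact ⟨0, Submodule.zero_mem _, 0, Φ, LegendreEq.zero k x₀, H⟩

end Spectrum

end SphericalLayer

end

theorem proposition3 (k : ℤ) (hk : k ≠ 0) (x₀ : ℝ) (h0 : 0 < x₀) (h1 : x₀ < 1) :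
    SphericalLayer.problemSpectrum k 0 x₀ = {μ : ℂ | SphericalLayer.IsEigenvalue k 0 x₀ μ} ∧
    ∀ μ : ℂ, SphericalLayer.IsEigenvalue k 0 x₀ μ →
      (∃ δ : ℝ, 0 < δ ∧
        ∀ μ' ∈ SphericalLayer.problemSpectrum k 0 x₀, μ' ≠ μ → δ ≤ dist μ' μ) ∧
      (μ.im = 0 ∧ μ.re < 0) ∧
      (Module.finrank ℂ (SphericalLayer.rootSpace k 0 x₀ h0 h1 μ) = 1 ∨
        (Module.finrank ℂ (SphericalLayer.rootSpace k 0 x₀ h0 h1 μ) = 2 ∧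
          ∃ Ψe ∈ SphericalLayer.eigenspace k 0 x₀ h0 h1 μ,
          ∃ Ψo ∈ SphericalLayer.eigenspace k 0 x₀ h0 h1 μ,
            (∀ x, Ψe (-x) = Ψe x) ∧ (∀ x, Ψo (-x) = -Ψo x) ∧
            LinearIndependent ℂ ![Ψe, Ψo])) := by
  obtain ⟨T, R, hc, hs, hn, -, hto, hof⟩ := SphericalLayer.exists_symmetric_operator hk h0 h1
  have hiff := SphericalLayer.isEigenvalue_iff hk h0 h1 hto hof
  have hspec : SphericalLayer.problemSpectrum k 0 x₀ =
      {μ : ℂ | SphericalLayer.IsEigenvalue k 0 x₀ μ} := by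
    ext μ
    refine ⟨fun h => ?_, fun h => SphericalLayer.IsEigenvalue.not_isResolventPoint h⟩
    by_contra hne
    refine h (SphericalLayer.isResolventPoint_of_isUnit hk h0 h1 hto hof
      (SphericalLayer.isUnit_one_sub_smul hc fun v hv => ?_))
    by_contra hv0
    exact hne ((hiff μ).2 ⟨v, hv0, hv⟩)
  refine ⟨hspec, fun μ hμ => ?_⟩
  obtain ⟨φ, hφ, e⟩ := (hiff μ).1 hμ
  have hconj := SphericalLayer.conj_eq_of_eq_smul hs hφ e
  refine ⟨?_, ?_, ?_⟩
  · obtain ⟨δ, hδ, H⟩ := SphericalLayer.exists_forall_dist_lt hc hs hconj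
    refine ⟨δ, hδ, fun μ' hμ' hne => ?_⟩
    rw [hspec] at hμ'
    obtain ⟨v, hv, ev⟩ := (hiff μ').1 hμ'
    by_contra hd
    exact hv (H μ' (not_le.1 hd) hne v ev)
  -- Here `0 < ‖φ‖² = μ ⟪φ, T φ⟫ = μ r` with `r ≤ 0`, which forces `μ < 0`.
  · obtain ⟨r, hr, er⟩ := hn φ
    have h2 : (inner ℂ φ φ : ℂ) = μ * r := by
      rw [← er, ← inner_smul_right, ← e]
    have hpos : 0 < ‖φ‖ ^ 2 := by positivity
    have h4 : ‖φ‖ ^ 2 = μ.re * r := by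
      rw [← inner_self_eq_norm_sq (𝕜 := ℂ), h2]
      exact Complex.re_mul_ofReal _ _
    refine ⟨Complex.conj_eq_iff_im.1 hconj, ?_⟩
    by_contra hneg
    nlinarith [mul_nonneg (not_lt.1 hneg) (neg_nonneg.2 hr)]
  · rw [SphericalLayer.rootSpace_eq_eigenspace hk h0 h1]
    exact SphericalLayer.finrank_eigenspace hk h0 h1 hμ
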